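/- **Notation.** Let $\ell$ be a prime. For a profinite group $H$ let $\bar C_\bullet(H)_\ell$ be the profinite bar complex: $\bar C_n(H)_\ell=\mathbb Z_\ell[\![H^n]\!]=\varprojlim_S\mathbb Z_\ell[S]$ ($S$ running over the finite discrete quotients of the space $H^n$) with its inverse limit topology and the continuous differential $$\partial_n[h_1|\cdots|h_n]=[h_2|\cdots|h_n]+\sum_{0<j<n}(-1)^j[h_1|\cdots|h_jh_{j+1}|\cdots|h_n]+(-1)^n[h_1|\cdots|h_{n-1}].$$ Its homology is $H_\bullet(H,\mathbb Z_\ell)$, and $Z_2(H)_\ell=\ker\partial_2$. For $h\in H$ let $F_h:\bar C_n(H)_\ell\to\bar C_{n+1}(H)_\ell$ be the continuous $\mathbb Z_\ell$-linear map with $$F_h[g_1|\cdots|g_n]=\sum_{r=0}^n(-1)^r[g_1|\cdots|g_r|h^{-1}|hg_{r+1}h^{-1}|\cdots|hg_nh^{-1}].$$ If $C\subseteq H$ is a closed subgroup, $h\in H$ centralizes $C$ and $z\in Z_2(C)_\ell$, then $F_h(z)$ is a cycle. Let $H_3^{\rm dec}(H,\mathbb Z_\ell)\subseteq H_3(H,\mathbb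 Z_\ell)$ be the $\mathbb Z_\ell$-submodule generated by the classes $[F_h(z)]$ for all such $C,h,z$. Continuous homomorphisms induce maps on all these objects, denoted by the same symbols. **Setting.** Suppose given: * a topologically finitely generated profinite group $\Gamma$ with $H_2(\Gamma,\mathbb Z_\ell)\simeq\mathbb Z_\ell$ and $H_3(\Gamma,\mathbb Z_\ell)=0$. The group ${\rm Aut}(\Gamma)$ of continuous automorphisms has the topology in which the subgroups of automorphisms that are trivial modulo $\Gamma_n$, $n\ge1$, form a basis of neighbourhoods of the identity, where $\Gamma_n$ is the intersection of the open normal subgroups of $\Gamma$ of index dividing $n$; ${\rm Out}(\Gamma)={\rm Aut}(\Gamma)/{\rm Inn}(\Gamma)$; * a commutative ring $\mathcal O$ and a complete local Noetherian $\mathcal O$-algebra $A$ with maximal ideal $\mathfrak m$ and finite residue field of characteristic $\ell$, with its $\mathfrak m$-adic topology; ${\rm Aut}_{\mathcal O\text{-alg}}(A)$ has the topology in which the subgroups $\{f: f\equiv{\rm id}\bmod\mathfrak m^n\}$ form a basis of neighbourhoods of the identity; * an integer $d\ge2$ and a continuous representation $\rho:\Gamma\to{\rm GL}_d(A)$; *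 a profinite group $G$, a continuous homomorphism $\phi:G\to{\rm Aut}_{\mathcal O\text{-alg}}(A)$, a homomorphism $\psi:G\to{\rm Out}(\Gamma)$ and a continuous map $\tilde\psi:G\to{\rm Aut}(\Gamma)$ that lifts $\psi$. The group $G$ acts on ${\rm GL}_d(A)$ and on $\bar C_\bullet({\rm GL}_d(A))_\ell$ through $\phi$; * a topological $\mathbb Z_\ell$-module $B(A)_\ell$ with a continuous $\mathbb Z_\ell$-linear action of $G$, and a continuous $\mathbb Z_\ell$-linear $G$-equivariant map $\mathfrak r:\bar C_3({\rm GL}_d(A))_\ell/{\rm Im}(\partial_4)\to B(A)_\ell$ that vanishes on $H_3^{\rm dec}({\rm GL}_d(A),\mathbb Z_\ell)$. Suppose that for each $\sigma\in G$ the representation $\gamma\mapsto\phi(\sigma)^{-1}(\rho(\tilde\psi(\sigma)(\gamma)))$ is equivalent to $\rho$, that is, conjugate to it by an element of ${\rm GL}_d(A)$. Fix a $\mathbb Z_\ell$-generator $[c]$ of $H_2(\Gamma,\mathbb Z_\ell)$. **Proposition.** There is a continuous character $a:G\to\mathbb Z_\ell^\times$, $\sigma\mapsto a_\sigma$, such that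 every lift of $\psi(\sigma)$ to ${\rm Aut}(\Gamma)$ acts on $H_2(\Gamma,\mathbb Z_\ell)$ as multiplication by $a_\sigma$. Let $B(A)_\ell(-1)$ be the module $B(A)_\ell$ on which $\sigma\in G$ acts by $b\mapsto a_\sigma^{-1}\sigma(b)$. Choose $c\in Z_2(\Gamma)_\ell$ that represents $[c]$ and, for each $\sigma$, an element $h_{\tilde\psi(\sigma)}\in{\rm GL}_d(A)$ with $$\rho(\tilde\psi(\sigma)(\gamma))=h_{\tilde\psi(\sigma)}\,\phi(\sigma)(\rho(\gamma))\,h_{\tilde\psi(\sigma)}^{-1}\quad\text{for all }\gamma\in\Gamma;$$ such elements exist. The cycle $a_\sigma^{-1}\tilde\psi(\sigma)(c)-c$ is a boundary; regard it as an element of $\bar C_3(\Gamma)_\ell/{\rm Im}(\partial_4)$ through the injection $\partial_3$ into $Z_2(\Gamma)_\ell$. Then $$\sigma\mapsto\mathfrak r\rho\bigl(a_\sigma^{-1}\tilde\psi(\sigma)(c)-c\bigr)-a_\sigma^{-1}\,\mathfrak rF_{h_{\tilde\psi(\sigma)}}\bigl(\phi(\sigma)(\rho(c))\bigr)$$ is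 a continuous $1$-cocycle $G\to B(A)_\ell(-1)$. Its class $${\rm Vol}_{\rho,\psi,\phi}\in H^1_{\rm cts}(G,B(A)_\ell(-1))$$ (continuous $1$-cocycles modulo $1$-coboundaries), for the given $B(A)_\ell$ and $\mathfrak r$, depends only on $[c]$, $\psi$, $\phi$ and the equivalence class of $\rho$: it does not change if $c$ is replaced by another cycle in the class $[c]$, $\tilde\psi$ by another continuous lift of $\psi$, the elements $h_{\tilde\psi(\sigma)}$ by other choices, or $\rho$ by an equivalent representation. -/

import Mathlib

open Topology

noncomputable section

namespace ProfiniteVolume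

/-! ### The completed free module `ℤ_ℓ⟦X⟧` of a profinite space -/

section Completed

variable (ℓ : ℕ) [Fact ℓ.Prime]

/-- The inverse limit of the free modules `ℤ_ℓ[S]` over the discrete quotients `S` of `X`, as a
submodule of the product: the families `u` such that `ℤ_ℓ[S] → ℤ_ℓ[T]` takes `u S` to `u T`
whenever the quotient `S` is finer than `T`. -/
def compatibleFamilies (X : Type*) [TopologicalSpace X] :
    Submodule ℤ_[ℓ] ((S : DiscreteQuotient X) → (S →₀ ℤ_[ℓ])) where
  carrier := {u | ∀ (S T : DiscreteQuotient X) (hST : S ≤ T),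
    (u S).mapDomain (DiscreteQuotient.ofLE hST) = u T}
  zero_mem' := fun _ _ _ => Finsupp.mapDomain_zero
  add_mem' := fun {u v} hu hv S T hST => by
    simp only [Pi.add_apply, Finsupp.mapDomain_add, hu S T hST, hv S T hST]
  smul_mem' := fun r u hu S T hST => by
    simp only [Pi.smul_apply, Finsupp.mapDomain_smul, hu S T hST]

/-- `ℤ_ℓ⟦X⟧ = lim_S ℤ_ℓ[S]`, where `S` runs over the discrete quotients of `X`; these are finite
when `X` is compact. -/
def Completed (X : Type*) [TopologicalSpace X] : Type _ := ↥(compatibleFamilies ℓ X)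

instance (X : Type*) [TopologicalSpace X] : AddCommGroup (Completed ℓ X) :=
  inferInstanceAs (AddCommGroup ↥(compatibleFamilies ℓ X))

instance (X : Type*) [TopologicalSpace X] : Module ℤ_[ℓ] (Completed ℓ X) :=
  inferInstanceAs (Module ℤ_[ℓ] ↥(compatibleFamilies ℓ X))

/-- The inverse limit topology: the coarsest one for which all the coordinates
`Completed ℓ X → ℤ_ℓ[S] → ℤ_ℓ` are continuous, where `ℤ_ℓ` carries the `ℓ`-adic topology. -/
instance (X : Type*) [TopologicalSpace X] : TopologicalSpace (Completed ℓ X) :=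
  TopologicalSpace.induced
    (fun u => fun (p : (S : DiscreteQuotient X) × S) => u.1 p.1 p.2) inferInstance

theorem leComap_comap {X Y : Type*} [TopologicalSpace X] [TopologicalSpace Y] (f : C(X, Y))
    (T : DiscreteQuotient Y) : DiscreteQuotient.LEComap f (T.comap f) T :=
  le_refl (T.comap f)

/-- The map `ℤ_ℓ⟦X⟧ → ℤ_ℓ⟦Y⟧` induced by a continuous map `f : X → Y`. -/
def push {X Y : Type*} [TopologicalSpace X] [TopologicalSpace Y] (f : C(X, Y)) :
    Completed ℓ X →ₗ[ℤ_[ℓ]] Completed ℓ Y where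
  toFun u := ⟨fun T => (u.1 (T.comap f)).mapDomain (DiscreteQuotient.map f (leComap_comap f T)), by
    intro S T hST
    have h := u.2 (S.comap f) (T.comap f) (DiscreteQuotient.comap_mono f hST)
    change Finsupp.mapDomain _ (Finsupp.mapDomain _ _) = Finsupp.mapDomain _ _
    rw [← h, ← Finsupp.mapDomain_comp, ← Finsupp.mapDomain_comp, DiscreteQuotient.ofLE_comp_map,
      DiscreteQuotient.map_comp_ofLE]⟩
  map_add' u v := Subtype.ext (funext fun _ => Finsupp.mapDomain_add)
  map_smul' r u := Subtype.ext (funext fun _ => Finsupp.mapDomain_smul r _)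

end Completed

/-! ### Profinite bar complex, homology and conjugation homotopy -/

section Bar

variable (ℓ : ℕ) [Fact ℓ.Prime]
variable (H : Type*) [Group H] [TopologicalSpace H] [IsTopologicalGroup H]

/-- The chain group `C̄_n(H)_ℓ = ℤ_ℓ⟦Hⁿ⟧`, with topological basis the symbols `[h₁|…|hₙ]`. -/
abbrev Chains (n : ℕ) : Type _ := Completed ℓ (Fin n → H)

variable {H}

/-- `[h₁|…|hₙ₊₁] ↦ [h₂|…|hₙ₊₁]`. -/
def firstFace (n : ℕ) : C(Fin (n + 1) → H, Fin n → H) :=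
  ⟨fun g i => g i.succ, by fun_prop⟩

/-- For `j < n`, multiply the neighbouring entries at the (zero-based) positions `j`, `j + 1`;
for `j = n`, drop the last entry. -/
def innerFace (n : ℕ) (j : Fin (n + 1)) : C(Fin (n + 1) → H, Fin n → H) :=
  ⟨fun g => Fin.contractNth j (· * ·) g, by
    refine continuous_pi fun k => ?_
    unfold Fin.contractNth
    split_ifs <;> fun_prop⟩

variable (H) in
/-- The boundary `∂ₙ₊₁ : C̄ₙ₊₁(H)_ℓ → C̄ₙ(H)_ℓ` of the bar complex. -/
def boundary (n : ℕ) : Chains ℓ H (n + 1) →ₗ[ℤ_[ℓ]] Chains ℓ H n :=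
  push ℓ (firstFace n) + ∑ j : Fin (n + 1), (-1 : ℤ_[ℓ]) ^ ((j : ℕ) + 1) • push ℓ (innerFace n j)

variable (H) in
/-- The cycles `Zₙ₊₁(H)_ℓ`, the kernel of `∂ₙ₊₁`. -/
abbrev cycles (n : ℕ) : Submodule ℤ_[ℓ] (Chains ℓ H (n + 1)) := LinearMap.ker (boundary ℓ H n)

variable (H) in
/-- The boundaries in `C̄ₙ(H)_ℓ`, the image of `∂ₙ₊₁`. -/
abbrev boundaries (n : ℕ) : Submodule ℤ_[ℓ] (Chains ℓ H n) := LinearMap.range (boundary ℓ H n)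

variable (H) in
/-- `H₂(H, ℤ_ℓ) = Ker ∂₂ / Im ∂₃`. -/
abbrev H2 : Type _ := ↥(cycles ℓ H 1) ⧸ (boundaries ℓ H 2).submoduleOf (cycles ℓ H 1)

variable (H) in
/-- `H₃(H, ℤ_ℓ) = Ker ∂₃ / Im ∂₄`. -/
abbrev H3 : Type _ := ↥(cycles ℓ H 2) ⧸ (boundaries ℓ H 3).submoduleOf (cycles ℓ H 2)

variable (H) in
/-- `C̄₃(H)_ℓ / Im ∂₄`, with the quotient topology. -/
abbrev D3 : Type _ := Chains ℓ H 3 ⧸ boundaries ℓ H 3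

/-- The chain map induced by a continuous homomorphism: `[h₁|…|hₙ] ↦ [f h₁|…|f hₙ]`. -/
def chainMap {K : Type*} [Group K] [TopologicalSpace K] (f : H →ₜ* K) (n : ℕ) :
    Chains ℓ H n →ₗ[ℤ_[ℓ]] Chains ℓ K n :=
  push ℓ ⟨fun g i => f (g i),
    continuous_pi fun i => f.continuous_toFun.comp (continuous_apply i)⟩

/-- `[g₁|…|gₙ] ↦ [g₁|…|g_r|h⁻¹|h g_{r+1} h⁻¹|…|h gₙ h⁻¹]`. -/
def prism (h : H) (n : ℕ) (r : Fin (n + 1)) : C(Fin n → H, Fin (n + 1) → H) :=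
  ⟨fun g => Fin.insertNth r h⁻¹
      (fun i : Fin n => if i.castSucc < r then g i else h * g i * h⁻¹), by
    refine continuous_pi fun k => ?_
    induction k using Fin.succAboveCases r with
    | x => simp only [Fin.insertNth_apply_same]; fun_prop
    | p i =>
      simp only [Fin.insertNth_apply_succAbove]
      split_ifs <;> fun_prop⟩

/-- The homotopy `F_h = ∑_r (-1)^r [g₁|…|g_r|h⁻¹|h g_{r+1} h⁻¹|…|h gₙ h⁻¹]` between the identity
and conjugation by `h`. -/
def homotopyF (h : H) (n : ℕ) : Chains ℓ H n →ₗ[ℤ_[ℓ]] Chains ℓ H (n + 1) :=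
  ∑ r : Fin (n + 1), (-1 : ℤ_[ℓ]) ^ (r : ℕ) • push ℓ (prism h n r)

/-- The inclusion of a subgroup, as a continuous homomorphism. -/
def inclusion (C : Subgroup H) : ↥C →ₜ* H := ⟨C.subtype, continuous_subtype_val⟩

variable (H) in
/-- The decomposable classes `H₃^dec(H, ℤ_ℓ)`, inside `H₃(H, ℤ_ℓ) ⊆ C̄₃(H)_ℓ / Im ∂₄`: the span
of the classes `∇_{h,C}(z) = [F_h(z)]`, for `C` a closed subgroup, `h` an element that centralizes
`C`, and `z` a 2-cycle of `C`. -/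
def decomposable : Submodule ℤ_[ℓ] (D3 ℓ H) :=
  Submodule.span ℤ_[ℓ]
    {w | ∃ (C : Subgroup H) (_ : IsClosed (C : Set H)) (h : H) (_ : h ∈ Subgroup.centralizer (C : Set H))
      (z : Chains ℓ ↥C 2) (_ : z ∈ cycles ℓ ↥C 1),
      w = (boundaries ℓ H 3).mkQ (homotopyF ℓ h 2 (chainMap ℓ (inclusion C) 2 z))}

end Bar

/-! ### Automorphism groups and their topologies -/

section Aut

variable (H : Type*) [Group H] [TopologicalSpace H]

/-- The group of continuous automorphisms, with composition as product. -/
instance : Group (H ≃ₜ* H) where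
  mul α β := β.trans α
  one := ContinuousMulEquiv.refl H
  inv α := α.symm
  mul_assoc _ _ _ := rfl
  one_mul _ := rfl
  mul_one _ := rfl
  inv_mul_cancel α := ContinuousMulEquiv.ext fun x => α.symm_apply_apply x

/-- The intersection of the open normal subgroups of index dividing `n`. -/
def charSubgroup (n : ℕ) : Subgroup H :=
  ⨅ (N : OpenNormalSubgroup H) (_ : N.toSubgroup.index ∣ n), N.toSubgroup

/-- The topology on `Aut(H)` for which the automorphisms that are trivial modulo
`charSubgroup H n`, for `n ≥ 1`, form a basis of neighbourhoods of the identity: `U` is open if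
with `α` it contains some coset `α · {δ | δ ≡ id mod charSubgroup H n}`. -/
@[reducible] def autTopology : TopologicalSpace (H ≃ₜ* H) where
  IsOpen U := ∀ α ∈ U, ∃ n : ℕ, 0 < n ∧
    ∀ δ : H ≃ₜ* H, (∀ x, x⁻¹ * δ x ∈ charSubgroup H n) → α * δ ∈ U
  isOpen_univ := fun _ _ => ⟨1, one_pos, fun _ _ => trivial⟩
  isOpen_inter := fun U V hU hV α hα => by
    obtain ⟨n, hn, h1⟩ := hU α hα.1
    obtain ⟨m, hm, h2⟩ := hV α hα.2
    have key : ∀ k, k ∣ n * m → charSubgroup H (n * m) ≤ charSubgroup H k := fun k hk =>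
      le_iInf₂ fun N hN => iInf₂_le N (hN.trans hk)
    exact ⟨n * m, Nat.mul_pos hn hm, fun δ hδ =>
      ⟨h1 δ fun x => key n (dvd_mul_right n m) (hδ x),
        h2 δ fun x => key m (dvd_mul_left m n) (hδ x)⟩⟩
  isOpen_sUnion := fun s hs α hα => by
    obtain ⟨U, hU, hαU⟩ := hα
    obtain ⟨n, hn, h⟩ := hs U hU α hαU
    exact ⟨n, hn, fun δ hδ => ⟨U, hU, h δ hδ⟩⟩

variable [IsTopologicalGroup H]

/-- Conjugation `x ↦ h x h⁻¹`, as a homomorphism `H → Aut(H)`. -/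
def conj : H →* (H ≃ₜ* H) where
  toFun h :=
    { MulAut.conj h with
      continuous_toFun := by
        change Continuous fun x => h * x * h⁻¹
        fun_prop
      continuous_invFun := by
        change Continuous fun x => h⁻¹ * x * h
        fun_prop }
  map_one' := ContinuousMulEquiv.ext fun x => by
    change 1 * x * 1⁻¹ = x
    simp
  map_mul' g h := ContinuousMulEquiv.ext fun x => by
    change g * h * x * (g * h)⁻¹ = g * (h * x * h⁻¹) * g⁻¹
    group

/-- The inner automorphisms. -/
def Inn : Subgroup (H ≃ₜ* H) := (conj H).range

instance : (Inn H).Normal where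
  conj_mem := by
    rintro _ ⟨h, rfl⟩ α
    refine ⟨α h, ContinuousMulEquiv.ext fun x => ?_⟩
    change α h * x * (α h)⁻¹ = α (h * α.symm x * h⁻¹)
    simp

/-- `Out(H) = Aut(H) / Inn(H)`. -/
abbrev Out : Type _ := (H ≃ₜ* H) ⧸ Inn H

variable {H} in
/-- An automorphism as a continuous homomorphism. -/
def autHom (α : H ≃ₜ* H) : H →ₜ* H := ⟨α.toMulEquiv.toMonoidHom, α.continuous_toFun⟩

end Aut

section AlgAut

open IsLocalRing

variable (O A : Type*) [CommRing O] [CommRing A] [IsLocalRing A] [Algebra O A]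

/-- The topology on the group of `O`-algebra automorphisms of `A` for which the subgroups
`Kₙ = {f | f ≡ id mod 𝔪ⁿ}` form a basis of neighbourhoods of the identity: `U` is open if with
`f` it contains some coset `f · Kₙ`. -/
@[reducible] def algAutTopology : TopologicalSpace (A ≃ₐ[O] A) where
  IsOpen U := ∀ f ∈ U, ∃ n : ℕ,
    ∀ δ : A ≃ₐ[O] A, (∀ x, δ x - x ∈ maximalIdeal A ^ n) → f * δ ∈ U
  isOpen_univ := fun _ _ => ⟨1, fun _ _ => trivial⟩
  isOpen_inter := fun U V hU hV f hf => by
    obtain ⟨n, h1⟩ := hU f hf.1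
    obtain ⟨m, h2⟩ := hV f hf.2
    exact ⟨n + m, fun δ hδ =>
      ⟨h1 δ fun x => Ideal.pow_le_pow_right (Nat.le_add_right n m) (hδ x),
        h2 δ fun x => Ideal.pow_le_pow_right (Nat.le_add_left m n) (hδ x)⟩⟩
  isOpen_sUnion := fun s hs f hf => by
    obtain ⟨U, hU, hfU⟩ := hf
    obtain ⟨n, h⟩ := hs U hU f hfU
    exact ⟨n, fun δ hδ => ⟨U, hU, h δ hδ⟩⟩

variable {O A} [TopologicalSpace A] [IsTopologicalRing A]

/-- Automorphisms of a local ring are continuous for the `𝔪`-adic topology. -/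
theorem continuous_algEquiv (hA : IsAdic (maximalIdeal A)) (f : A ≃ₐ[O] A) : Continuous f := by
  have hmem : ∀ x ∈ maximalIdeal A, f x ∈ maximalIdeal A := fun x hx => by
    rw [mem_maximalIdeal, mem_nonunits_iff] at hx ⊢
    exact fun h => hx ((MulEquiv.isUnit_map f).1 h)
  have hpow : ∀ n, maximalIdeal A ^ n ≤ (maximalIdeal A ^ n).comap (f : A →+* A) := fun n => by
    refine le_trans (Ideal.pow_right_mono (J := (maximalIdeal A).comap (f : A →+* A)) hmem n) ?_
    exact Ideal.le_comap_pow _ n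
  refine continuous_of_continuousAt_zero (f : A →+ A) ?_
  rw [ContinuousAt, map_zero]
  exact (hA.hasBasis_nhds_zero.tendsto_iff hA.hasBasis_nhds_zero).2
    fun n _ => ⟨n, trivial, fun x hx => hpow n hx⟩

/-- The action of an automorphism of `A` on `GL_d(A)`, entry by entry. -/
def glMap (hA : IsAdic (maximalIdeal A)) (d : ℕ) (f : A ≃ₐ[O] A) : GL (Fin d) A →ₜ* GL (Fin d) A :=
  ⟨Matrix.GeneralLinearGroup.map (f : A →+* A),
    Continuous.units_map _ (continuous_id.matrix_map (continuous_algEquiv hA f))⟩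

end AlgAut

/-- Equivalence of two representations in `GL_d(A)`: conjugation by an element of `GL_d(A)`. -/
def RepEquiv {Γ A : Type*} [CommRing A] {d : ℕ} (ρ ρ' : Γ → GL (Fin d) A) : Prop :=
  ∃ g : GL (Fin d) A, ∀ γ, ρ' γ = g * ρ γ * g⁻¹

/-! ### Continuous cohomology in degree one -/

section Cohomology

variable {ℓ : ℕ} [Fact ℓ.Prime] {G : Type*} [Group G] [TopologicalSpace G]
variable {B : Type*} [AddCommGroup B] [Module ℤ_[ℓ] B] [TopologicalSpace B]

/-- The twist `B(-1)`: the module `B` with `σ` acting by `b ↦ a_σ⁻¹ · σ(b)`. -/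
def twist (B : Type*) [AddCommGroup B] [Module ℤ_[ℓ] B] [DistribMulAction G B]
    [SMulCommClass G ℤ_[ℓ] B] (a : G →* ℤ_[ℓ]ˣ) : Representation ℤ_[ℓ] G B where
  toFun σ :=
    { toFun := fun b => ((a σ)⁻¹ : ℤ_[ℓ]ˣ) • σ • b
      map_add' := fun b b' => by simp only [smul_add]
      map_smul' := fun r b => by
        rw [smul_comm σ r b, RingHom.id_apply, Units.smul_def, Units.smul_def, smul_comm] }
  map_one' := LinearMap.ext fun b => by simp
  map_mul' σ τ := LinearMap.ext fun b => by
    change ((a (σ * τ))⁻¹ : ℤ_[ℓ]ˣ) • (σ * τ) • b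
      = ((a σ)⁻¹ : ℤ_[ℓ]ˣ) • σ • ((a τ)⁻¹ : ℤ_[ℓ]ˣ) • τ • b
    rw [map_mul, mul_inv, mul_smul, mul_smul, Units.smul_def (a τ)⁻¹ (σ • τ • b),
      Units.smul_def (a τ)⁻¹ (τ • b), smul_comm σ _ (τ • b)]

variable [IsTopologicalAddGroup B] [ContinuousSMul ℤ_[ℓ] B]

/-- Continuous 1-cocycles: `f(στ) = f(σ) + σ·f(τ)`. -/
def Z1cts (π : Representation ℤ_[ℓ] G B) : Submodule ℤ_[ℓ] (G → B) where
  carrier := {f | Continuous f ∧ ∀ σ τ, f (σ * τ) = f σ + π σ (f τ)}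
  zero_mem' := ⟨continuous_const, fun _ _ => by simp⟩
  add_mem' := fun {f g} hf hg => ⟨hf.1.add hg.1, fun σ τ => by
    simp only [Pi.add_apply, hf.2 σ τ, hg.2 σ τ, map_add]
    abel⟩
  smul_mem' := fun r f hf => ⟨hf.1.const_smul r, fun σ τ => by
    simp only [Pi.smul_apply, hf.2 σ τ, map_smul, smul_add]⟩

/-- 1-coboundaries: `f(σ) = σ·b - b`. -/
def B1 (π : Representation ℤ_[ℓ] G B) : Submodule ℤ_[ℓ] (G → B) :=
  LinearMap.range (LinearMap.pi fun σ => π σ - LinearMap.id)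

/-- `H¹_cts(G, B)`, continuous 1-cocycles modulo 1-coboundaries. -/
abbrev H1cts (π : Representation ℤ_[ℓ] G B) : Type _ :=
  ↥(Z1cts π) ⧸ (B1 π).submoduleOf (Z1cts π)

end Cohomology

/-! ### The volume cochain -/

section Volume

variable {ℓ : ℕ} [Fact ℓ.Prime]
variable {Γ : Type*} [Group Γ] [TopologicalSpace Γ] [IsTopologicalGroup Γ]
variable {O A : Type*} [CommRing O] [CommRing A] [IsLocalRing A] [Algebra O A]
  [TopologicalSpace A] [IsTopologicalRing A]
variable {G : Type*} [Group G]
variable {B : Type*} [AddCommGroup B] [Module ℤ_[ℓ] B] [TopologicalSpace B]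

/-- The cochain `σ ↦ 𝔯ρ(a_σ⁻¹ ψ̃(σ)(c) - c) - a_σ⁻¹ 𝔯 F_{h_σ}(φ(σ)(ρ(c)))`. Here
`a_σ⁻¹ ψ̃(σ)(c) - c`, which is a 2-boundary of `Γ`, is seen as an element of `C̄₃(Γ)_ℓ / Im ∂₄`
through `∂₃`: it is given by a 3-chain `e σ` with that boundary. -/
def volCochain (hA : IsAdic (IsLocalRing.maximalIdeal A)) {d : ℕ}
    (φ : G →* (A ≃ₐ[O] A)) (r : D3 ℓ (GL (Fin d) A) →L[ℤ_[ℓ]] B) (a : G →* ℤ_[ℓ]ˣ)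
    (ρ : Γ →ₜ* GL (Fin d) A) (c : Chains ℓ Γ 2)
    (h : G → GL (Fin d) A) (e : G → Chains ℓ Γ 3) : G → B := fun σ =>
  r ((boundaries ℓ (GL (Fin d) A) 3).mkQ (chainMap ℓ ρ 3 (e σ)))
    - ((a σ)⁻¹ : ℤ_[ℓ]ˣ) • r ((boundaries ℓ (GL (Fin d) A) 3).mkQ
        (homotopyF ℓ (h σ) 2 (chainMap ℓ (glMap hA d (φ σ)) 2 (chainMap ℓ ρ 2 c))))

end Volume

end ProfiniteVolume

end

/-! The map `F_h` is a chain homotopy from the identity to conjugation by `h`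
(`boundary_homotopyF_two`, `boundary_homotopyF_three`), and on 2-cycles it obeys `F_{gh} = F_h + F_g
∘ conj_h` modulo `Im ∂₄` (`boundary_homotopyG_two`). Everything algebraic follows from these two
facts and naturality.

Write `t = a_σ⁻¹`, `s = φ(σ)`, and let `e` bound `t ψ̃(σ)(c) - c`. The value `vol` at `σ` does not
depend on the choice of `h` and `e`: two bounding chains differ by a 3-cycle, which bounds because
`H₃(Γ) = 0`, and two intertwiners `h`, `k` differ by the element `k⁻¹h`, which centralizes the image
of `s ∘ ρ`, so the discrepancy is the regulator of a decomposable class (`vol_congr`). Each relation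
therefore needs to be checked only for well-chosen `h` and `e`. For a product of automorphisms the
obvious composite choices give the cocycle relation exactly (`vol_mul`). Changing a lift by an inner
automorphism does not change the value (`vol_inner_mul`), so `ψ̃` need not be multiplicative.
Replacing `c` by `c + ∂w`, or `ρ` by `gρg⁻¹`, adds the coboundary of the regulator of `ρ(w)`,
respectively of `F_g(ρ(c))` (`vol_add_boundary`, `vol_conj`).

Continuity needs no continuous choice of `h` and `e`. The admissible triples `(σ, h, e)` form a
closed subset of a compact space that surjects onto `G`, hence maps to `G` by a quotient map; the
value is continuous on triples and depends only on `σ` (`continuous_of_closed_correspondence`). The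
same argument makes the character continuous. That character exists because `H₂(Γ)` is free of rank
one and `F_g` makes inner automorphisms act trivially on it. -/

noncomputable section

namespace ProfiniteVolume

/-! ### Topology of the completed free modules -/

section CompletedModule

variable {ℓ : ℕ} [Fact ℓ.Prime]
variable {X Y Z : Type*} [TopologicalSpace X] [TopologicalSpace Y] [TopologicalSpace Z]

variable (ℓ X) in
/-- The coordinates of an element of `ℤ_ℓ⟦X⟧`, indexed by the pairs of a discrete quotient of `X`
and a point of it. -/
def coords : Completed ℓ X →ₗ[ℤ_[ℓ]] (((S : DiscreteQuotient X) × S) → ℤ_[ℓ]) where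
  toFun u p := u.1 p.1 p.2
  map_add' _ _ := rfl
  map_smul' _ _ := rfl

theorem isInducing_coords : IsInducing (coords ℓ X) := ⟨rfl⟩

theorem coords_injective : Function.Injective (coords ℓ X) := fun _ _ h =>
  Subtype.ext (funext fun S => Finsupp.ext fun s => congrFun h ⟨S, s⟩)

instance : T2Space (Completed ℓ X) :=
  (IsEmbedding.mk isInducing_coords coords_injective).t2Space

instance : IsTopologicalAddGroup (Completed ℓ X) :=
  topologicalAddGroup_induced (coords ℓ X)

instance : ContinuousSMul ℤ_[ℓ] (Completed ℓ X) :=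
  continuousSMul_induced (coords ℓ X)

theorem continuous_completed_iff {f : Y → Completed ℓ X} :
    Continuous f ↔ ∀ (S : DiscreteQuotient X) (s : S), Continuous fun y => (f y).1 S s := by
  rw [isInducing_coords.continuous_iff, continuous_pi_iff]
  exact ⟨fun h S s => h ⟨S, s⟩, fun h p => h p.1 p.2⟩

theorem continuous_coord (S : DiscreteQuotient X) (s : S) :
    Continuous fun u : Completed ℓ X => u.1 S s :=
  continuous_completed_iff.1 continuous_id S s

theorem mapDomain_apply_eq_sum {α β R : Type*} [Fintype α] [Semiring R] [DecidableEq β]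
    (f : α → β) (v : α →₀ R) (b : β) :
    v.mapDomain f b = ∑ a, if f a = b then v a else 0 := by
  rw [Finsupp.mapDomain, Finsupp.sum_fintype _ _ (by simp), Finsupp.finsetSum_apply]
  simp only [Finsupp.single_apply]

/-- Each discrete quotient is finite, so compatibility is a family of equations between finite sums
of coordinates. The coordinates thus embed the module as a closed subset of a product of copies of
the compact ring `ℤ_[ℓ]`. -/
instance [CompactSpace X] : CompactSpace (Completed ℓ X) := by
  classical
  have hemb : IsEmbedding (coords ℓ X) := ⟨isInducing_coords, coords_injective⟩
  refine IsClosedEmbedding.compactSpace (f := coords ℓ X) ⟨hemb, ?_⟩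
  have (S : DiscreteQuotient X) : Fintype S := Fintype.ofFinite S
  have hr : Set.range (coords ℓ X) = {v | ∀ (S T : DiscreteQuotient X) (hST : S ≤ T) (t : T),
      (∑ s : S, if DiscreteQuotient.ofLE hST s = t then v ⟨S, s⟩ else 0) = v ⟨T, t⟩} := by
    ext v
    constructor
    · rintro ⟨u, rfl⟩ S T hST t
      exact (mapDomain_apply_eq_sum (DiscreteQuotient.ofLE hST) (u.1 S) t).symm.trans
        (DFunLike.congr_fun (u.2 S T hST) t)
    · intro hv
      refine ⟨⟨fun S => Finsupp.equivFunOnFinite.symm fun s => v ⟨S, s⟩, fun S T hST => ?_⟩, rfl⟩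
      ext t
      rw [mapDomain_apply_eq_sum]
      exact hv S T hST t
  rw [hr]
  simp only [Set.ofPred_forall]
  refine isClosed_iInter fun S => isClosed_iInter fun T => isClosed_iInter fun hST =>
    isClosed_iInter fun t => isClosed_eq (continuous_finsetSum _ fun s _ => ?_) (continuous_apply _)
  split_ifs
  · exact continuous_apply _
  · exact continuous_const

/-- The freedom in `S` allows two different maps to be compared on a common refinement. -/
theorem push_coord_eq (f : C(X, Y)) (u : Completed ℓ X) {S : DiscreteQuotient X}
    {T : DiscreteQuotient Y} (h : DiscreteQuotient.LEComap f S T) :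
    (push ℓ f u).1 T = (u.1 S).mapDomain (DiscreteQuotient.map f h) := by
  have hle : S ≤ T.comap f := h
  change (u.1 (T.comap f)).mapDomain _ = _
  rw [← u.2 S (T.comap f) hle, ← Finsupp.mapDomain_comp, DiscreteQuotient.map_comp_ofLE]

theorem push_coord_congr {f g : C(X, Y)} {T : DiscreteQuotient Y}
    (h : ∀ x, T.proj (f x) = T.proj (g x)) (u : Completed ℓ X) :
    (push ℓ f u).1 T = (push ℓ g u).1 T := by
  have hf : DiscreteQuotient.LEComap f (T.comap f ⊓ T.comap g) T := fun x y hxy => hxy.1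
  have hg : DiscreteQuotient.LEComap g (T.comap f ⊓ T.comap g) T := fun x y hxy => hxy.2
  rw [push_coord_eq f u hf, push_coord_eq g u hg]
  congr 1
  funext s
  obtain ⟨x, rfl⟩ := DiscreteQuotient.proj_surjective _ s
  rw [DiscreteQuotient.map_proj, DiscreteQuotient.map_proj, h]

/-- The push-forward of a fixed element depends continuously on the map. -/
theorem continuous_push_family [CompactSpace X] (f : Y → C(X, Z))
    (hf : Continuous fun p : Y × X => f p.1 p.2) (u : Completed ℓ X) :
    Continuous fun y => push ℓ (f y) u := by
  refine continuous_completed_iff.2 fun T t => IsLocallyConstant.continuous ?_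
  rw [IsLocallyConstant.iff_eventually_eq]
  intro y₀
  -- By compactness of `X`, the maps `f y` and `f y₀` agree modulo `T` at all points at once for `y`
  -- near `y₀`, so each coordinate is locally constant in `y`.
  have hev : ∀ᶠ y in 𝓝 y₀, ∀ x ∈ (Set.univ : Set X), T.proj (f y x) = T.proj (f y₀ x) := by
    refine isCompact_univ.eventually_forall_of_forall_eventually fun x _ => ?_
    have hc : Continuous fun p : Y × X => (T.proj (f p.1 p.2), T.proj (f y₀ p.2)) :=
      (T.proj_continuous.comp hf).prodMk
        (T.proj_continuous.comp ((f y₀).continuous.comp continuous_snd))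
    exact (hc.continuousAt (x := (y₀, x))).eventually (IsOpen.mem_nhds
      (isOpen_discrete {q : T × T | q.1 = q.2}) (Eq.refl (T.proj (f y₀ x))))
  filter_upwards [hev] with y hy
  rw [push_coord_congr (fun x => hy x trivial) u]

theorem continuous_push [CompactSpace X] (f : C(X, Y)) : Continuous (push ℓ f) := by
  classical
  refine continuous_completed_iff.2 fun T t => ?_
  have : Fintype (T.comap f) := Fintype.ofFinite _
  have h (u : Completed ℓ X) : (push ℓ f u).1 T t = ∑ s : T.comap f,
      if DiscreteQuotient.map f (leComap_comap f T) s = t then u.1 (T.comap f) s else 0 :=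
    mapDomain_apply_eq_sum _ _ _
  simp only [h]
  refine continuous_finsetSum _ fun s _ => ?_
  split_ifs
  · exact continuous_coord _ _
  · exact continuous_const

variable (ℓ) in
/-- The basis element `[x]` of `ℤ_ℓ⟦X⟧`. -/
def dirac (x : X) : Completed ℓ X :=
  ⟨fun S => Finsupp.single (S.proj x) 1, fun S T hST => by
    rw [Finsupp.mapDomain_single, DiscreteQuotient.ofLE_proj]⟩

theorem push_dirac (f : C(X, Y)) (x : X) : push ℓ f (dirac ℓ x) = dirac ℓ (f x) := by
  refine Subtype.ext (funext fun T => ?_)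
  change Finsupp.mapDomain _ (Finsupp.single _ _) = _
  rw [Finsupp.mapDomain_single, DiscreteQuotient.map_proj]
  rfl

theorem dense_span_dirac :
    Dense (Submodule.span ℤ_[ℓ] (Set.range (dirac ℓ (X := X))) : Set (Completed ℓ X)) := by
  intro u
  rw [mem_closure_iff_nhds]
  intro U hU
  rw [isInducing_coords.nhds_eq_comap, Filter.mem_comap] at hU
  obtain ⟨V, hV, hVU⟩ := hU
  rw [nhds_pi, Filter.mem_pi] at hV
  obtain ⟨I, hI, t, ht, hIt⟩ := hV
  -- A basic neighbourhood constrains finitely many coordinates, all of which are read off from this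
  -- common refinement. Lifting `u.1 S` to representatives in `X` matches them exactly.
  let S : DiscreteQuotient X := hI.toFinset.inf Sigma.fst
  let w : Completed ℓ X := (u.1 S).sum fun s a => a • dirac ℓ (Quotient.out s)
  refine ⟨w, hVU (hIt fun p hp => ?_), ?_⟩
  · have hS : S ≤ p.1 := Finset.inf_le (f := Sigma.fst) (hI.mem_toFinset.2 hp)
    have hw : w.1 S = u.1 S := by
      have h1 : w.1 S = (u.1 S).sum fun s a => a • (dirac ℓ (Quotient.out s) : Completed ℓ X).1 S :=
        map_finsuppSum ((LinearMap.proj S).comp (compatibleFamilies ℓ X).subtype) _ _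
      rw [h1]
      conv_rhs => rw [← Finsupp.sum_single (u.1 S)]
      refine Finsupp.sum_congr fun s _ => ?_
      change u.1 S s • Finsupp.single (S.proj (Quotient.out s)) 1 = _
      rw [Finsupp.smul_single, smul_eq_mul, mul_one]
      congr 1
      exact Quotient.out_eq s
    have he : coords ℓ X w p = coords ℓ X u p := by
      change w.1 p.1 p.2 = u.1 p.1 p.2
      rw [← w.2 S p.1 hS, ← u.2 S p.1 hS, hw]
    rw [he]
    exact mem_of_mem_nhds (ht p)
  · exact Submodule.sum_mem _ fun s _ =>
      Submodule.smul_mem _ _ (Submodule.subset_span ⟨_, rfl⟩)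

/-- Continuous linear maps on `ℤ_ℓ⟦X⟧` that agree on the basis elements are equal. -/
theorem eq_of_dirac {M : Type*} [AddCommGroup M] [Module ℤ_[ℓ] M] [TopologicalSpace M] [T2Space M]
    {L L' : Completed ℓ X →ₗ[ℤ_[ℓ]] M} (hL : Continuous L) (hL' : Continuous L')
    (h : ∀ x, L (dirac ℓ x) = L' (dirac ℓ x)) : L = L' := by
  refine DFunLike.coe_injective (Continuous.ext_on dense_span_dirac hL hL' fun u hu => ?_)
  exact LinearMap.eqOn_span (by rintro _ ⟨x, rfl⟩; exact h x) hu

theorem push_push (f : C(X, Y)) (g : C(Y, Z)) (u : Completed ℓ X) :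
    push ℓ g (push ℓ f u) = push ℓ (g.comp f) u := by
  refine Subtype.ext (funext fun T => ?_)
  change Finsupp.mapDomain _ (Finsupp.mapDomain _ _) = Finsupp.mapDomain _ _
  rw [← Finsupp.mapDomain_comp, ← DiscreteQuotient.map_comp]
  rfl

end CompletedModule

/-! ### Homotopy identities in the bar complex -/

section BarIdentities

variable {ℓ : ℕ} [Fact ℓ.Prime]
variable {H : Type*} [Group H] [TopologicalSpace H] [IsTopologicalGroup H]

theorem continuous_boundary [CompactSpace H] (n : ℕ) : Continuous (boundary ℓ H n) := by
  have h : (boundary ℓ H n : Chains ℓ H (n + 1) → Chains ℓ H n) = fun u =>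
      push ℓ (firstFace n) u
        + ∑ j : Fin (n + 1), (-1 : ℤ_[ℓ]) ^ ((j : ℕ) + 1) • push ℓ (innerFace n j) u := by
    funext u
    simp [boundary]
  rw [h]
  exact (continuous_push _).add (continuous_finsetSum _ fun j _ =>
    (continuous_push _).const_smul ((-1 : ℤ_[ℓ]) ^ _))

theorem homotopyF_apply (h : H) (n : ℕ) (u : Chains ℓ H n) :
    homotopyF ℓ h n u = ∑ r : Fin (n + 1), (-1 : ℤ_[ℓ]) ^ (r : ℕ) • push ℓ (prism h n r) u := by
  simp [homotopyF]

theorem continuous_homotopyF [CompactSpace H] (h : H) (n : ℕ) :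
    Continuous (homotopyF ℓ h n) := by
  simp only [funext (homotopyF_apply (ℓ := ℓ) h n)]
  exact continuous_finsetSum _ fun j _ =>
    (continuous_push _).const_smul ((-1 : ℤ_[ℓ]) ^ _)

/-- The map on chains induced by conjugation by `h`. -/
abbrev conjChain (ℓ : ℕ) [Fact ℓ.Prime] (h : H) (n : ℕ) : Chains ℓ H n →ₗ[ℤ_[ℓ]] Chains ℓ H n :=
  chainMap ℓ (autHom (conj H h)) n

/-- The homotopy that compares `F_{gh}` with `F_h + F_g ∘ conj_h`. -/
def homotopyG (ℓ : ℕ) [Fact ℓ.Prime] (g h : H) (n : ℕ) :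
    Chains ℓ H n →ₗ[ℤ_[ℓ]] Chains ℓ H (n + 2) :=
  ∑ r : Fin (n + 1), ∑ s : Fin (n + 1),
    if r ≤ s then (-1 : ℤ_[ℓ]) ^ ((r : ℕ) + (s : ℕ) + 1) •
      (push ℓ (prism g (n + 1) s.succ) ∘ₗ push ℓ (prism h n r)) else 0

theorem continuous_homotopyG [CompactSpace H] (g h : H) (n : ℕ) :
    Continuous (homotopyG ℓ g h n) := by
  have key : (homotopyG ℓ g h n : Chains ℓ H n → Chains ℓ H (n + 2)) = fun u =>
      ∑ r : Fin (n + 1), ∑ s : Fin (n + 1),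
        if r ≤ s then (-1 : ℤ_[ℓ]) ^ ((r : ℕ) + (s : ℕ) + 1) •
          (push ℓ (prism g (n + 1) s.succ) (push ℓ (prism h n r) u)) else 0 := by
    funext u
    simp only [homotopyG, LinearMap.sum_apply]
    refine Finset.sum_congr rfl fun r _ => Finset.sum_congr rfl fun s _ => ?_
    split_ifs <;> simp
  rw [key]
  refine continuous_finsetSum _ fun r _ => continuous_finsetSum _ fun s _ => ?_
  split_ifs
  · exact ((continuous_push (prism g (n + 1) s.succ)).comp
      (continuous_push (prism h n r))).const_smul ((-1 : ℤ_[ℓ]) ^ _)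
  · exact continuous_const

theorem continuous_conjChain [CompactSpace H] (h : H) (n : ℕ) : Continuous (conjChain ℓ h n) :=
  continuous_push _

theorem conjChain_dirac (h : H) (n : ℕ) (x : Fin n → H) :
    conjChain ℓ h n (dirac ℓ x) = dirac ℓ fun i => h * x i * h⁻¹ :=
  push_dirac _ _

theorem prism_one_zero (h a : H) : prism h 1 0 ![a] = ![h⁻¹, h * a * h⁻¹] := by
  funext i; fin_cases i <;> rfl
theorem prism_one_one (h a : H) : prism h 1 1 ![a] = ![a, h⁻¹] := by
  funext i; fin_cases i <;> rfl
theorem prism_two_zero (h a b : H) :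
    prism h 2 0 ![a, b] = ![h⁻¹, h * a * h⁻¹, h * b * h⁻¹] := by
  funext i; fin_cases i <;> rfl
theorem prism_two_one (h a b : H) : prism h 2 1 ![a, b] = ![a, h⁻¹, h * b * h⁻¹] := by
  funext i; fin_cases i <;> rfl
theorem prism_two_two (h a b : H) : prism h 2 2 ![a, b] = ![a, b, h⁻¹] := by
  funext i; fin_cases i <;> rfl
theorem prism_three_zero (h a b c : H) :
    prism h 3 0 ![a, b, c] = ![h⁻¹, h * a * h⁻¹, h * b * h⁻¹, h * c * h⁻¹] := by
  funext i; fin_cases i <;> rfl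
theorem prism_three_one (h a b c : H) :
    prism h 3 1 ![a, b, c] = ![a, h⁻¹, h * b * h⁻¹, h * c * h⁻¹] := by
  funext i; fin_cases i <;> rfl
theorem prism_three_two (h a b c : H) :
    prism h 3 2 ![a, b, c] = ![a, b, h⁻¹, h * c * h⁻¹] := by
  funext i; fin_cases i <;> rfl
theorem prism_three_three (h a b c : H) : prism h 3 3 ![a, b, c] = ![a, b, c, h⁻¹] := by
  funext i; fin_cases i <;> rfl

theorem homotopyF_one_dirac (h a : H) : homotopyF ℓ h 1 (dirac ℓ ![a])
    = dirac ℓ ![h⁻¹, h * a * h⁻¹] - dirac ℓ ![a, h⁻¹] := by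
  rw [homotopyF_apply, Fin.sum_univ_two]
  simp only [push_dirac, prism_one_zero, prism_one_one, Fin.val_zero, Fin.val_one]
  module

theorem homotopyF_two_dirac (h a b : H) : homotopyF ℓ h 2 (dirac ℓ ![a, b])
    = dirac ℓ ![h⁻¹, h * a * h⁻¹, h * b * h⁻¹] - dirac ℓ ![a, h⁻¹, h * b * h⁻¹]
      + dirac ℓ ![a, b, h⁻¹] := by
  rw [homotopyF_apply, Fin.sum_univ_three]
  simp only [push_dirac, prism_two_zero, prism_two_one, prism_two_two, Fin.val_zero, Fin.val_one,
    Fin.val_two]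
  module

theorem homotopyF_three_dirac (h a b c : H) : homotopyF ℓ h 3 (dirac ℓ ![a, b, c])
    = dirac ℓ ![h⁻¹, h * a * h⁻¹, h * b * h⁻¹, h * c * h⁻¹]
      - dirac ℓ ![a, h⁻¹, h * b * h⁻¹, h * c * h⁻¹]
      + dirac ℓ ![a, b, h⁻¹, h * c * h⁻¹] - dirac ℓ ![a, b, c, h⁻¹] := by
  rw [homotopyF_apply, Fin.sum_univ_four]
  simp only [push_dirac, prism_three_zero, prism_three_one, prism_three_two, prism_three_three,
    Fin.val_zero, Fin.val_one, Fin.val_two,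
    show ((3 : Fin 4) : ℕ) = 3 from rfl]
  module

theorem boundary_apply (n : ℕ) (u : Chains ℓ H (n + 1)) :
    boundary ℓ H n u = push ℓ (firstFace n) u
      + ∑ j : Fin (n + 1), (-1 : ℤ_[ℓ]) ^ ((j : ℕ) + 1) • push ℓ (innerFace n j) u := by
  simp [boundary]

theorem boundary_one_dirac (a b : H) : boundary ℓ H 1 (dirac ℓ ![a, b])
    = dirac ℓ ![b] - dirac ℓ ![a * b] + dirac ℓ ![a] := by
  have h0 : firstFace 1 ![a, b] = ![b] := by funext i; fin_cases i; rfl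
  have h1 : innerFace 1 0 ![a, b] = ![a * b] := by funext i; fin_cases i; rfl
  have h2 : innerFace 1 1 ![a, b] = ![a] := by funext i; fin_cases i; rfl
  rw [boundary_apply, Fin.sum_univ_two]
  simp only [push_dirac, h0, h1, h2, Fin.val_zero, Fin.val_one]
  module

theorem boundary_two_dirac (a b c : H) : boundary ℓ H 2 (dirac ℓ ![a, b, c])
    = dirac ℓ ![b, c] - dirac ℓ ![a * b, c] + dirac ℓ ![a, b * c] - dirac ℓ ![a, b] := by
  have h0 : firstFace 2 ![a, b, c] = ![b, c] := by funext i; fin_cases i <;> rfl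
  have h1 : innerFace 2 0 ![a, b, c] = ![a * b, c] := by funext i; fin_cases i <;> rfl
  have h2 : innerFace 2 1 ![a, b, c] = ![a, b * c] := by funext i; fin_cases i <;> rfl
  have h3 : innerFace 2 2 ![a, b, c] = ![a, b] := by funext i; fin_cases i <;> rfl
  rw [boundary_apply, Fin.sum_univ_three]
  simp only [push_dirac, h0, h1, h2, h3, Fin.val_zero, Fin.val_one, Fin.val_two]
  module

theorem boundary_three_dirac (a b c d : H) : boundary ℓ H 3 (dirac ℓ ![a, b, c, d])
    = dirac ℓ ![b, c, d] - dirac ℓ ![a * b, c, d] + dirac ℓ ![a, b * c, d]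
      - dirac ℓ ![a, b, c * d] + dirac ℓ ![a, b, c] := by
  have h0 : firstFace 3 ![a, b, c, d] = ![b, c, d] := by funext i; fin_cases i <;> rfl
  have h1 : innerFace 3 0 ![a, b, c, d] = ![a * b, c, d] := by funext i; fin_cases i <;> rfl
  have h2 : innerFace 3 1 ![a, b, c, d] = ![a, b * c, d] := by funext i; fin_cases i <;> rfl
  have h3 : innerFace 3 2 ![a, b, c, d] = ![a, b, c * d] := by funext i; fin_cases i <;> rfl
  have h4 : innerFace 3 3 ![a, b, c, d] = ![a, b, c] := by funext i; fin_cases i <;> rfl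
  rw [boundary_apply, Fin.sum_univ_four]
  simp only [push_dirac, h0, h1, h2, h3, h4, Fin.val_zero, Fin.val_one, Fin.val_two,
    show ((3 : Fin 4) : ℕ) = 3 from rfl]
  module

theorem homotopyG_one_dirac (g h a : H) : homotopyG ℓ g h 1 (dirac ℓ ![a])
    = - dirac ℓ ![h⁻¹, g⁻¹, g * (h * a * h⁻¹) * g⁻¹]
      + dirac ℓ ![h⁻¹, h * a * h⁻¹, g⁻¹] - dirac ℓ ![a, h⁻¹, g⁻¹] := by
  simp [homotopyG, Fin.sum_univ_two, push_dirac, prism_one_zero, prism_one_one, prism_two_one,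
    prism_two_two]
  module

theorem homotopyG_two_dirac (g h a b : H) : homotopyG ℓ g h 2 (dirac ℓ ![a, b])
    = - dirac ℓ ![h⁻¹, g⁻¹, g * (h * a * h⁻¹) * g⁻¹, g * (h * b * h⁻¹) * g⁻¹]
      + dirac ℓ ![h⁻¹, h * a * h⁻¹, g⁻¹, g * (h * b * h⁻¹) * g⁻¹]
      - dirac ℓ ![h⁻¹, h * a * h⁻¹, h * b * h⁻¹, g⁻¹]
      - dirac ℓ ![a, h⁻¹, g⁻¹, g * (h * b * h⁻¹) * g⁻¹]
      + dirac ℓ ![a, h⁻¹, h * b * h⁻¹, g⁻¹]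
      - dirac ℓ ![a, b, h⁻¹, g⁻¹] := by
  simp [homotopyG, Fin.sum_univ_three, push_dirac, prism_two_zero, prism_two_one, prism_two_two,
    prism_three_one, prism_three_two, prism_three_three]
  module

theorem conjChain_two_dirac (h a b : H) :
    conjChain ℓ h 2 (dirac ℓ ![a, b]) = dirac ℓ ![h * a * h⁻¹, h * b * h⁻¹] := by
  rw [conjChain_dirac]
  congr 1
  funext i; fin_cases i <;> rfl

theorem conjChain_three_dirac (h a b c : H) :
    conjChain ℓ h 3 (dirac ℓ ![a, b, c])
      = dirac ℓ ![h * a * h⁻¹, h * b * h⁻¹, h * c * h⁻¹] := by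
  rw [conjChain_dirac]
  congr 1
  funext i; fin_cases i <;> rfl

/-- The faces that merge `h⁻¹` with `g⁻¹` give `F_{gh}`, those that drop a final `g⁻¹` give `-F_h`,
and those that drop an initial `h⁻¹` give `-F_g ∘ conj_h`. The others cancel or form the term in
`∂[a|b]`. -/
theorem boundary_homotopyG_two_dirac (g h a b : H) :
    boundary ℓ H 3 (homotopyG ℓ g h 2 (dirac ℓ ![a, b]))
        - homotopyG ℓ g h 1 (boundary ℓ H 1 (dirac ℓ ![a, b]))
      = homotopyF ℓ (g * h) 2 (dirac ℓ ![a, b]) - homotopyF ℓ h 2 (dirac ℓ ![a, b])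
        - homotopyF ℓ g 2 (conjChain ℓ h 2 (dirac ℓ ![a, b])) := by
  simp only [homotopyG_two_dirac, boundary_one_dirac,
    map_add, map_sub, map_neg, boundary_three_dirac, homotopyG_one_dirac, homotopyF_two_dirac,
    conjChain_two_dirac]
  simp only [mul_assoc, inv_mul_cancel_left, mul_inv_rev]
  abel

variable [CompactSpace H]

/-- The usual prism argument: the inner faces cancel against `F ∂`, and what remains are the two
ends. By density it is enough to see this on symbols. -/
theorem boundary_homotopyF_two (h : H) (u : Chains ℓ H 2) :
    boundary ℓ H 2 (homotopyF ℓ h 2 u) + homotopyF ℓ h 1 (boundary ℓ H 1 u)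
      = conjChain ℓ h 2 u - u := by
  refine LinearMap.congr_fun (eq_of_dirac
    (L := boundary ℓ H 2 ∘ₗ homotopyF ℓ h 2 + homotopyF ℓ h 1 ∘ₗ boundary ℓ H 1)
    (L' := conjChain ℓ h 2 - LinearMap.id) ?_ ?_ fun x => ?_) u
  · exact ((continuous_boundary 2).comp (continuous_homotopyF h 2)).add
      ((continuous_homotopyF h 1).comp (continuous_boundary 1))
  · exact (continuous_conjChain h _).sub continuous_id
  obtain ⟨a, b, rfl⟩ : ∃ a b, x = ![a, b] := ⟨x 0, x 1, by ext i; fin_cases i <;> rfl⟩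
  simp only [LinearMap.add_apply, LinearMap.sub_apply, LinearMap.comp_apply, LinearMap.id_apply,
    homotopyF_two_dirac, boundary_one_dirac, map_add, map_sub, boundary_two_dirac,
    homotopyF_one_dirac, conjChain_two_dirac]
  simp only [mul_assoc, inv_mul_cancel_left]
  module

theorem boundary_homotopyF_three (h : H) (u : Chains ℓ H 3) :
    boundary ℓ H 3 (homotopyF ℓ h 3 u) + homotopyF ℓ h 2 (boundary ℓ H 2 u)
      = conjChain ℓ h 3 u - u := by
  refine LinearMap.congr_fun (eq_of_dirac
    (L := boundary ℓ H 3 ∘ₗ homotopyF ℓ h 3 + homotopyF ℓ h 2 ∘ₗ boundary ℓ H 2)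
    (L' := conjChain ℓ h 3 - LinearMap.id) ?_ ?_ fun x => ?_) u
  · exact ((continuous_boundary 3).comp (continuous_homotopyF h 3)).add
      ((continuous_homotopyF h 2).comp (continuous_boundary 2))
  · exact (continuous_conjChain h _).sub continuous_id
  obtain ⟨a, b, c, rfl⟩ : ∃ a b c, x = ![a, b, c] :=
    ⟨x 0, x 1, x 2, by ext i; fin_cases i <;> rfl⟩
  simp only [LinearMap.add_apply, LinearMap.sub_apply, LinearMap.comp_apply, LinearMap.id_apply,
    homotopyF_three_dirac, boundary_two_dirac, map_add, map_sub, boundary_three_dirac,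
    homotopyF_two_dirac, conjChain_three_dirac]
  simp only [mul_assoc, inv_mul_cancel_left]
  module

/-- Both `F_{gh}` and the concatenation of `F_h` with `F_g ∘ conj_h` are homotopies from the
identity to `conj_{gh}`; `homotopyG` fills the triangle between them. -/
theorem boundary_homotopyG_two (g h : H) (u : Chains ℓ H 2) :
    boundary ℓ H 3 (homotopyG ℓ g h 2 u) - homotopyG ℓ g h 1 (boundary ℓ H 1 u)
      = homotopyF ℓ (g * h) 2 u - homotopyF ℓ h 2 u - homotopyF ℓ g 2 (conjChain ℓ h 2 u) := by
  refine LinearMap.congr_fun (eq_of_dirac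
    (L := boundary ℓ H 3 ∘ₗ homotopyG ℓ g h 2 - homotopyG ℓ g h 1 ∘ₗ boundary ℓ H 1)
    (L' := homotopyF ℓ (g * h) 2 - homotopyF ℓ h 2 - homotopyF ℓ g 2 ∘ₗ conjChain ℓ h 2)
    ?_ ?_ fun x => ?_) u
  · exact ((continuous_boundary 3).comp (continuous_homotopyG g h 2)).sub
      ((continuous_homotopyG g h 1).comp (continuous_boundary 1))
  · exact ((continuous_homotopyF _ 2).sub (continuous_homotopyF _ 2)).sub
      ((continuous_homotopyF g 2).comp (continuous_conjChain h 2))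
  obtain ⟨a, b, rfl⟩ : ∃ a b, x = ![a, b] := ⟨x 0, x 1, by ext i; fin_cases i <;> rfl⟩
  exact boundary_homotopyG_two_dirac g h a b

end BarIdentities

/-! ### Compactness and joint continuity of actions -/

section Topological

/-- A map `f` out of a compact Hausdorff space is continuous as soon as, over some closed
correspondence with a compact space, it lifts to a continuous map. -/
theorem continuous_of_closed_correspondence {X Y Z : Type*} [TopologicalSpace X]
    [TopologicalSpace Y] [TopologicalSpace Z] [CompactSpace X] [T2Space X] [CompactSpace Y]
    {K : Set (X × Y)} (hK : IsClosed K) (hsurj : ∀ x, ∃ y, (x, y) ∈ K) {f : X → Z}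
    {F : X × Y → Z} (hF : Continuous F) (hfF : ∀ p ∈ K, f p.1 = F p) : Continuous f := by
  have : CompactSpace K := isCompact_iff_compactSpace.1 hK.isCompact
  let π : K → X := fun p => p.1.1
  have hπ : Continuous π := continuous_fst.comp continuous_subtype_val
  -- A continuous map from a compact space to a Hausdorff space is closed, and a closed continuous
  -- surjection is a quotient map.
  have hq : IsQuotientMap π := hπ.isClosedMap.isQuotientMap hπ fun x =>
    let ⟨y, hy⟩ := hsurj x
    ⟨⟨(x, y), hy⟩, rfl⟩
  rw [hq.continuous_iff]
  convert hF.comp continuous_subtype_val using 1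
  funext p
  exact hfF p.1 p.2

-- Complete and totally bounded: the quotients by powers of the maximal ideal are finite, since the
-- ideal is finitely generated and the residue field is finite.
open IsLocalRing in
theorem compactSpace_of_isAdic {A : Type*} [CommRing A] [IsLocalRing A] [IsNoetherianRing A]
    [IsAdicComplete (maximalIdeal A) A] [Finite (ResidueField A)] [TopologicalSpace A]
    [IsTopologicalRing A] (hA : IsAdic (maximalIdeal A)) : CompactSpace A := by
  let _ : UniformSpace A := IsTopologicalAddGroup.rightUniformSpace A
  have : IsUniformAddGroup A := isUniformAddGroup_of_addCommGroup
  have hc : CompleteSpace A := (hA.isAdicComplete_iff.1 inferInstance).1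
  refine ⟨isCompact_iff_totallyBounded_isComplete.2 ⟨?_, completeSpace_iff_isComplete_univ.1 hc⟩⟩
  rw [hA.hasBasis_nhds_zero.uniformity_of_nhds_zero.totallyBounded_iff]
  intro n _
  have : Finite (A ⧸ maximalIdeal A) := inferInstanceAs (Finite (ResidueField A))
  have : Finite (A ⧸ maximalIdeal A ^ n) :=
    Ideal.finite_quotient_pow (IsNoetherian.noetherian _) n
  refine ⟨Set.range fun q : A ⧸ maximalIdeal A ^ n => Quotient.out q, Set.finite_range _,
    fun x _ => Set.mem_iUnion₂.2 ⟨_, ⟨Ideal.Quotient.mk _ x, rfl⟩, ?_⟩⟩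
  change _ ∈ maximalIdeal A ^ n
  rw [← Ideal.Quotient.eq]
  exact Ideal.Quotient.mk_out _

theorem charSubgroup_index_le {Γ : Type*} [Group Γ] [TopologicalSpace Γ]
    (N : OpenNormalSubgroup Γ) : charSubgroup Γ N.toSubgroup.index ≤ N.toSubgroup :=
  iInf_le_of_le N (iInf_le _ (dvd_refl _))

variable {Y : Type*} [TopologicalSpace Y]

theorem continuous_autTopology_eval {Γ : Type*} [Group Γ] [TopologicalSpace Γ]
    [IsTopologicalGroup Γ] [CompactSpace Γ] [T2Space Γ] [TotallyDisconnectedSpace Γ]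
    {f : Y → (Γ ≃ₜ* Γ)} (hf : Continuous[inferInstance, autTopology Γ] f) :
    Continuous fun p : Y × Γ => f p.1 p.2 := by
  rw [continuous_iff_continuousAt]
  rintro ⟨y₀, x₀⟩
  set α := f y₀
  intro W hW
  have hW' : (fun z => α x₀ * z) ⁻¹' W ∈ 𝓝 (1 : Γ) :=
    (continuous_const_mul (α x₀)).continuousAt (by simpa using hW)
  obtain ⟨V, hVW, hVo, h1V⟩ := mem_nhds_iff.1 hW'
  obtain ⟨N, hN⟩ := ProfiniteGrp.exist_openNormalSubgroup_sub_open_nhds_of_one hVo h1V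
  -- The preimage `α⁻¹(N)`: if `α⁻¹β` is trivial modulo it, then `β x` and `α x` agree modulo `N`
  -- for every `x`. Its index serves as the `n` of a basic neighbourhood of `α`.
  let N' : OpenNormalSubgroup Γ := 
    { N.toOpenSubgroup.comap (autHom α : Γ →* Γ) α.continuous_toFun with
      isNormal' := Subgroup.Normal.comap N.isNormal' (autHom α : Γ →* Γ) }
  have hn : 0 < N'.toSubgroup.index := by
    have : N'.toSubgroup.FiniteIndex := Subgroup.finiteIndex_of_finite_quotient
    exact Nat.pos_of_ne_zero Subgroup.FiniteIndex.index_ne_zero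
  let U : Set (Γ ≃ₜ* Γ) := {β | ∀ x, x⁻¹ * (α⁻¹ * β) x ∈ charSubgroup Γ N'.toSubgroup.index}
  have hU : IsOpen[autTopology Γ] U := fun β hβ => ⟨_, hn, fun δ hδ x => by
    have := mul_mem (hδ x) (hβ (δ x))
    rwa [show x⁻¹ * δ x * ((δ x)⁻¹ * (α⁻¹ * β) (δ x)) = x⁻¹ * (α⁻¹ * (β * δ)) x by
      rw [mul_assoc, mul_inv_cancel_left]; rfl] at this⟩
  have hαU : α ∈ U := fun x => by
    rw [inv_mul_cancel]
    change x⁻¹ * x ∈ _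
    rw [inv_mul_cancel]
    exact one_mem _
  have hUN : ∀ β ∈ U, ∀ x, (α x)⁻¹ * β x ∈ N := fun β hβ x => by
    have h1 : x⁻¹ * α.symm (β x) ∈ N'.toSubgroup :=
      charSubgroup_index_le N' (hβ x)
    have h2 : α (x⁻¹ * α.symm (β x)) ∈ N := h1
    rwa [map_mul, map_inv, ContinuousMulEquiv.apply_symm_apply] at h2
  have hy : ∀ᶠ y in 𝓝 y₀, f y ∈ U := (@Continuous.isOpen_preimage _ _ _ (_) _ hf U hU).mem_nhds hαU
  have hx : ∀ᶠ x in 𝓝 x₀, (α x₀)⁻¹ * α x ∈ N := by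
    have hc : Continuous fun x => (α x₀)⁻¹ * α x := continuous_const.mul α.continuous_toFun
    exact hc.continuousAt (N.isOpen'.mem_nhds (by
      rw [inv_mul_cancel]
      exact one_mem N))
  rw [Filter.mem_map, nhds_prod_eq]
  filter_upwards [hy.prod_mk hx] with p hp
  have h : (α x₀)⁻¹ * f p.1 p.2 ∈ N := by
    have := mul_mem hp.2 (hUN _ hp.1 p.2)
    rwa [mul_assoc, mul_inv_cancel_left] at this
  simpa using hVW (hN h)

variable {O A : Type*} [CommRing O] [CommRing A] [IsLocalRing A] [Algebra O A]
  [TopologicalSpace A]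

-- Automorphisms preserve the powers of the maximal ideal, so being close to `α` is a condition
-- uniform in the point of evaluation.
open IsLocalRing in
theorem continuous_algAutTopology_eval (hA : IsAdic (maximalIdeal A)) {f : Y → (A ≃ₐ[O] A)}
    (hf : Continuous[inferInstance, algAutTopology O A] f) :
    Continuous fun p : Y × A => f p.1 p.2 := by
  have hpow : ∀ (α : A ≃ₐ[O] A) (n : ℕ), ∀ x ∈ maximalIdeal A ^ n, α x ∈ maximalIdeal A ^ n := by
    intro α n
    have hmem : maximalIdeal A ≤ (maximalIdeal A).comap (α : A →+* A) := fun x hx => by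
      rw [Ideal.mem_comap, mem_maximalIdeal, mem_nonunits_iff]
      rw [mem_maximalIdeal, mem_nonunits_iff] at hx
      exact fun h => hx ((MulEquiv.isUnit_map α).1 h)
    exact (Ideal.pow_right_mono hmem n).trans (Ideal.le_comap_pow _ n)
  rw [continuous_iff_continuousAt]
  rintro ⟨y₀, x₀⟩
  set α := f y₀
  rw [ContinuousAt, (hA.hasBasis_nhds _).tendsto_right_iff]
  intro n _
  let U : Set (A ≃ₐ[O] A) := {β | ∀ x, (α⁻¹ * β) x - x ∈ maximalIdeal A ^ n}
  have hU : IsOpen[algAutTopology O A] U := fun β hβ => ⟨n, fun δ hδ x => by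
    have := add_mem (hβ (δ x)) (hδ x)
    rwa [sub_add_sub_cancel] at this⟩
  have hαU : α ∈ U := fun x => by
    rw [inv_mul_cancel, AlgEquiv.one_apply, sub_self]
    exact zero_mem _
  have hUN : ∀ β ∈ U, ∀ x, β x - α x ∈ maximalIdeal A ^ n := fun β hβ x => by
    have := hpow α n _ (hβ x)
    rwa [map_sub, ← AlgEquiv.mul_apply, mul_inv_cancel_left] at this
  have hy : ∀ᶠ y in 𝓝 y₀, f y ∈ U := (@Continuous.isOpen_preimage _ _ _ (_) _ hf U hU).mem_nhds hαU
  have hx : ∀ᶠ x in 𝓝 x₀, x - x₀ ∈ maximalIdeal A ^ n := by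
    filter_upwards [(hA.hasBasis_nhds x₀).mem_of_mem (i := n) trivial] with x hx
    obtain ⟨z, hz, rfl⟩ := hx
    simpa using hz
  rw [nhds_prod_eq]
  filter_upwards [hy.prod_mk hx] with p hp
  refine ⟨f p.1 p.2 - α x₀, ?_, add_sub_cancel _ _⟩
  have := add_mem (hUN _ hp.1 p.2) (hpow α n _ hp.2)
  rwa [map_sub, sub_add_sub_cancel] at this

open IsLocalRing in
theorem continuous_glMap_eval [IsTopologicalRing A] (hA : IsAdic (maximalIdeal A)) (d : ℕ) {f : Y → (A ≃ₐ[O] A)}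
    (hf : Continuous[inferInstance, algAutTopology O A] f) :
    Continuous fun p : Y × GL (Fin d) A => glMap hA d (f p.1) p.2 := by
  have h1 := continuous_algAutTopology_eval hA hf
  refine Units.continuous_iff.2 ⟨continuous_matrix fun i j => ?_, continuous_matrix fun i j => ?_⟩
  · exact h1.comp (continuous_fst.prodMk
      ((Units.continuous_val.comp continuous_snd).matrix_elem i j))
  · simp only [← map_inv]
    exact h1.comp (continuous_fst.prodMk
      ((Units.continuous_val.comp continuous_snd.inv).matrix_elem i j))

end Topological

/-! ### Functoriality of chain maps -/

section Functoriality

variable {ℓ : ℕ} [Fact ℓ.Prime]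
variable {H K L : Type*} [Group H] [TopologicalSpace H] [Group K] [TopologicalSpace K]
  [Group L] [TopologicalSpace L]

theorem chainMap_comp (g : K →ₜ* L) (f : H →ₜ* K) (n : ℕ) (u : Chains ℓ H n) :
    chainMap ℓ (g.comp f) n u = chainMap ℓ g n (chainMap ℓ f n u) :=
  Eq.symm <| by
    rw [chainMap, chainMap, push_push]
    rfl

theorem chainMap_autHom_mul (α β : H ≃ₜ* H) (n : ℕ) (u : Chains ℓ H n) :
    chainMap ℓ (autHom (α * β)) n u = chainMap ℓ (autHom α) n (chainMap ℓ (autHom β) n u) :=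
  chainMap_comp (autHom α) (autHom β) n u

theorem chainMap_autHom_one (n : ℕ) (u : Chains ℓ H n) :
    chainMap ℓ (autHom (1 : H ≃ₜ* H)) n u = u := by
  refine Subtype.ext (funext fun T => ?_)
  change Finsupp.mapDomain (DiscreteQuotient.map (ContinuousMap.id _)
    (DiscreteQuotient.leComap_id T)) (u.1 T) = u.1 T
  rw [DiscreteQuotient.map_id, Finsupp.mapDomain_id]

/-- Two composites of homomorphisms that agree on elements agree on chains. -/
theorem chainMap_chainMap_congr {K' : Type*} [Group K'] [TopologicalSpace K']
    {f : H →ₜ* K} {g : K →ₜ* L}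
    {f' : H →ₜ* K'} {g' : K' →ₜ* L} (hfg : ∀ x, g (f x) = g' (f' x)) (n : ℕ)
    (u : Chains ℓ H n) :
    chainMap ℓ g n (chainMap ℓ f n u) = chainMap ℓ g' n (chainMap ℓ f' n u) := by
  rw [← chainMap_comp, ← chainMap_comp, show g.comp f = g'.comp f' from
    ContinuousMonoidHom.ext hfg]

end Functoriality

/-! ### Compatibility with boundaries, homotopies and conjugation -/

section Naturality

variable {ℓ : ℕ} [Fact ℓ.Prime]
variable {H K : Type*} [Group H] [TopologicalSpace H] [IsTopologicalGroup H]
  [Group K] [TopologicalSpace K] [IsTopologicalGroup K]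

theorem boundary_chainMap (f : H →ₜ* K) (n : ℕ) (u : Chains ℓ H (n + 1)) :
    boundary ℓ K n (chainMap ℓ f (n + 1) u) = chainMap ℓ f n (boundary ℓ H n u) := by
  simp only [boundary_apply, chainMap, map_add, map_sum, map_smul, push_push]
  congr 1
  refine Finset.sum_congr rfl fun j _ => ?_
  congr 3
  ext g k
  change Fin.contractNth j (· * ·) (fun i => f (g i)) k = f (Fin.contractNth j (· * ·) g k)
  simp only [Fin.contractNth]
  split_ifs <;> simp

theorem homotopyF_chainMap (f : H →ₜ* K) (h : H) (n : ℕ) (u : Chains ℓ H n) :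
    homotopyF ℓ (f h) n (chainMap ℓ f n u) = chainMap ℓ f (n + 1) (homotopyF ℓ h n u) := by
  simp only [homotopyF_apply, chainMap, map_sum, map_smul, push_push]
  refine Finset.sum_congr rfl fun r _ => ?_
  congr 3
  ext g k
  change Fin.insertNth (α := fun _ => K) r (f h)⁻¹
      (fun i : Fin n => if i.castSucc < r then f (g i) else f h * f (g i) * (f h)⁻¹) k
    = f (Fin.insertNth (α := fun _ => H) r h⁻¹ (fun i : Fin n => if i.castSucc < r then g i else h * g i * h⁻¹) k)
  induction k using Fin.succAboveCases r with
  | x => simp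
  | p i =>
    simp only [Fin.insertNth_apply_succAbove]
    split_ifs <;> simp

-- This trades the automorphism of the source for a conjugation in the target, where `homotopyF` can
-- act.
omit [IsTopologicalGroup H] in
theorem conj_intertwine {f : H →ₜ* H} {ρ : H →ₜ* K} {s : K →ₜ* K} {h : K}
    (hh : ∀ x, ρ (f x) = h * s (ρ x) * h⁻¹) (n : ℕ) (u : Chains ℓ H n) :
    conjChain ℓ h n (chainMap ℓ s n (chainMap ℓ ρ n u))
      = chainMap ℓ ρ n (chainMap ℓ f n u) := by
  rw [← chainMap_comp]
  exact chainMap_chainMap_congr (g' := ρ) (f' := f) (fun x => (hh x).symm) n u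

theorem conjChain_chainMap (f : H →ₜ* K) (k : H) (n : ℕ) (u : Chains ℓ H n) :
    conjChain ℓ (f k) n (chainMap ℓ f n u) = chainMap ℓ f n (conjChain ℓ k n u) := by
  refine chainMap_chainMap_congr (fun x => ?_) n u
  change f k * f x * (f k)⁻¹ = f (k * x * k⁻¹)
  simp

end Naturality

/-! ### Algebra of the volume cochain at single automorphisms -/

section VolumeIdentities

variable {ℓ : ℕ} [Fact ℓ.Prime]
variable {Γ H : Type*} [Group Γ] [TopologicalSpace Γ] [IsTopologicalGroup Γ]
  [Group H] [TopologicalSpace H] [IsTopologicalGroup H] [CompactSpace H]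
variable {B : Type*} [AddCommGroup B] [Module ℤ_[ℓ] B]

/-- The value `R ρ(e) - t R F_h(s(ρ(c)))` of the volume cochain. -/
def vol (R : Chains ℓ H 3 →ₗ[ℤ_[ℓ]] B) (t : ℤ_[ℓ]) (s : H →ₜ* H) (ρ : Γ →ₜ* H)
    (c : Chains ℓ Γ 2) (h : H) (e : Chains ℓ Γ 3) : B :=
  R (chainMap ℓ ρ 3 e) - t • R (homotopyF ℓ h 2 (chainMap ℓ s 2 (chainMap ℓ ρ 2 c)))

variable {R : Chains ℓ H 3 →ₗ[ℤ_[ℓ]] B} (hR : ∀ v, R (boundary ℓ H 3 v) = 0)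
include hR

theorem apply_homotopyF_mul (g h : H) {w : Chains ℓ H 2} (hw : boundary ℓ H 1 w = 0) :
    R (homotopyF ℓ (g * h) 2 w)
      = R (homotopyF ℓ h 2 w) + R (homotopyF ℓ g 2 (conjChain ℓ h 2 w)) := by
  have := congrArg R (boundary_homotopyG_two g h w)
  rw [hw, map_zero, sub_zero, hR, map_sub, map_sub] at this
  rw [eq_comm, sub_sub, sub_eq_zero] at this
  exact this

theorem apply_conjChain (h : H) (y : Chains ℓ H 3) :
    R (conjChain ℓ h 3 y) = R y + R (homotopyF ℓ h 2 (boundary ℓ H 2 y)) := by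
  have := congrArg R (boundary_homotopyF_three h y)
  rw [map_add, hR, zero_add, map_sub] at this
  rw [this, add_sub_cancel]

variable {t t' : ℤ_[ℓ]} {s s' : H →ₜ* H} {ρ : Γ →ₜ* H} {c : Chains ℓ Γ 2} {h k : H}
  {e e' : Chains ℓ Γ 3} {α β : Γ ≃ₜ* Γ} {E : B →ₗ[ℤ_[ℓ]] B}

omit hR [CompactSpace H] in
theorem boundary_push_push_eq_zero (hc : boundary ℓ Γ 1 c = 0) :
    boundary ℓ H 1 (chainMap ℓ s 2 (chainMap ℓ ρ 2 c)) = 0 := by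
  rw [boundary_chainMap, boundary_chainMap, hc, map_zero, map_zero]

/-- Moving `α` past `ρ` on `e'` creates the term `F_h` of `s(ρ(β c))`; the product rule for `F_{h
s(k)}` creates the same term, and the two cancel. -/
theorem vol_mul (hE : ∀ u, R (chainMap ℓ s 3 u) = E (R u)) (hc : boundary ℓ Γ 1 c = 0)
    (hh : ∀ γ, ρ (α γ) = h * s (ρ γ) * h⁻¹) (hk : ∀ γ, ρ (β γ) = k * s' (ρ γ) * k⁻¹)
    (he' : boundary ℓ Γ 2 e' = t' • chainMap ℓ (autHom β) 2 c - c) :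
    vol R (t * t') (s.comp s') ρ c (h * s k) (e + t • chainMap ℓ (autHom α) 3 e')
      = vol R t s ρ c h e + t • E (vol R t' s' ρ c k e') := by
  have h1 : R (chainMap ℓ ρ 3 (chainMap ℓ (autHom α) 3 e'))
      = E (R (chainMap ℓ ρ 3 e'))
        + t' • R (homotopyF ℓ h 2 (chainMap ℓ s 2 (chainMap ℓ ρ 2 (chainMap ℓ (autHom β) 2 c))))
        - R (homotopyF ℓ h 2 (chainMap ℓ s 2 (chainMap ℓ ρ 2 c))) := by
    rw [← conj_intertwine (f := autHom α) hh, apply_conjChain hR, hE, boundary_chainMap,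
      boundary_chainMap, he']
    simp only [map_sub, map_smul]
    abel
  have h2 : R (homotopyF ℓ (h * s k) 2 (chainMap ℓ (s.comp s') 2 (chainMap ℓ ρ 2 c)))
      = E (R (homotopyF ℓ k 2 (chainMap ℓ s' 2 (chainMap ℓ ρ 2 c))))
        + R (homotopyF ℓ h 2
          (chainMap ℓ s 2 (chainMap ℓ ρ 2 (chainMap ℓ (autHom β) 2 c)))) := by
    rw [apply_homotopyF_mul hR _ _ (boundary_push_push_eq_zero hc), chainMap_comp,
      homotopyF_chainMap, hE, conjChain_chainMap, ← conj_intertwine (f := autHom β) hk]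
  simp only [vol, map_add, map_sub, map_smul, h1, h2]
  module

/-- The element `ρ g * h` and the chain `F_g(c) + conj_g(e)` are admissible for `conj_g ∘ α`. Both
terms of the volume then grow by the same `F_{ρ(g)}(ρ(α c))`, up to the factor `t`. -/
theorem vol_inner_mul [CompactSpace Γ] (hc : boundary ℓ Γ 1 c = 0)
    (hh : ∀ γ, ρ (α γ) = h * s (ρ γ) * h⁻¹)
    (he : boundary ℓ Γ 2 e = t • chainMap ℓ (autHom α) 2 c - c) (g : Γ) :
    vol R t s ρ c (ρ g * h) (homotopyF ℓ g 2 c + conjChain ℓ g 3 e) = vol R t s ρ c h e := by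
  have h1 : R (chainMap ℓ ρ 3 (conjChain ℓ g 3 e)) = R (chainMap ℓ ρ 3 e)
      + t • R (homotopyF ℓ (ρ g) 2 (chainMap ℓ ρ 2 (chainMap ℓ (autHom α) 2 c)))
      - R (chainMap ℓ ρ 3 (homotopyF ℓ g 2 c)) := by
    rw [← conjChain_chainMap, apply_conjChain hR, boundary_chainMap, he, ← homotopyF_chainMap]
    simp only [map_sub, map_smul]
    abel
  have h2 : R (homotopyF ℓ (ρ g * h) 2 (chainMap ℓ s 2 (chainMap ℓ ρ 2 c)))
      = R (homotopyF ℓ h 2 (chainMap ℓ s 2 (chainMap ℓ ρ 2 c)))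
        + R (homotopyF ℓ (ρ g) 2 (chainMap ℓ ρ 2 (chainMap ℓ (autHom α) 2 c))) := by
    rw [apply_homotopyF_mul hR _ _ (boundary_push_push_eq_zero hc),
      conj_intertwine (f := autHom α) hh]
  simp only [vol, map_add, h1, h2]
  module

theorem vol_add_boundary (hE : ∀ u, R (chainMap ℓ s 3 u) = E (R u))
    (hh : ∀ γ, ρ (α γ) = h * s (ρ γ) * h⁻¹) (w : Chains ℓ Γ 3) :
    vol R t s ρ (c + boundary ℓ Γ 2 w) h (e + (t • chainMap ℓ (autHom α) 3 w - w))
      = vol R t s ρ c h e + (t • E (R (chainMap ℓ ρ 3 w)) - R (chainMap ℓ ρ 3 w)) := by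
  have h1 : R (chainMap ℓ ρ 3 (chainMap ℓ (autHom α) 3 w)) = E (R (chainMap ℓ ρ 3 w))
      + R (homotopyF ℓ h 2 (chainMap ℓ s 2 (chainMap ℓ ρ 2 (boundary ℓ Γ 2 w)))) := by
    rw [← conj_intertwine (f := autHom α) hh, apply_conjChain hR, hE, boundary_chainMap,
      boundary_chainMap]
  simp only [vol, map_add, map_sub, map_smul, h1]
  module

theorem vol_conj {ρ₁ : Γ →ₜ* H} (hE : ∀ u, R (chainMap ℓ s 3 u) = E (R u))
    (hc : boundary ℓ Γ 1 c = 0) (hh : ∀ γ, ρ (α γ) = h * s (ρ γ) * h⁻¹)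
    (he : boundary ℓ Γ 2 e = t • chainMap ℓ (autHom α) 2 c - c) {g : H}
    (hg : ∀ γ, ρ₁ γ = g * ρ γ * g⁻¹) :
    vol R t s ρ₁ c (g * h * (s g)⁻¹) e = vol R t s ρ c h e
      + (t • E (R (homotopyF ℓ g 2 (chainMap ℓ ρ 2 c)))
        - R (homotopyF ℓ g 2 (chainMap ℓ ρ 2 c))) := by
  have hρ₁ (n : ℕ) (u : Chains ℓ Γ n) : chainMap ℓ ρ₁ n u = conjChain ℓ g n (chainMap ℓ ρ n u) := by
    rw [← chainMap_comp]
    congr 2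
    exact ContinuousMonoidHom.ext hg
  have h1 : R (chainMap ℓ ρ₁ 3 e) = R (chainMap ℓ ρ 3 e)
      + t • R (homotopyF ℓ g 2 (chainMap ℓ ρ 2 (chainMap ℓ (autHom α) 2 c)))
      - R (homotopyF ℓ g 2 (chainMap ℓ ρ 2 c)) := by
    rw [hρ₁, apply_conjChain hR, boundary_chainMap, he]
    simp only [map_sub, map_smul]
    abel
  have hw := boundary_push_push_eq_zero (s := s) (ρ := ρ) hc
  have h2 := apply_homotopyF_mul hR g h hw
  -- Factoring `g * h` in two ways gives the value at `g * h * (s g)⁻¹` without a formula for `F` at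
  -- an inverse.
  have h3 := apply_homotopyF_mul hR (g * h * (s g)⁻¹) (s g) hw
  rw [inv_mul_cancel_right, h2, conj_intertwine (f := autHom α) hh, conjChain_chainMap, ← hρ₁,
    homotopyF_chainMap, hE, ← sub_eq_iff_eq_add'] at h3
  simp only [vol, h1, ← h3]
  module

theorem vol_congr [T2Space H] (hΓ3 : ∀ u, boundary ℓ Γ 2 u = 0 → ∃ v, boundary ℓ Γ 3 v = u)
    (hdec : ∀ (C : Subgroup H), IsClosed (C : Set H) → ∀ g ∈ Subgroup.centralizer (C : Set H),
      ∀ z ∈ cycles ℓ C 1, R (homotopyF ℓ g 2 (chainMap ℓ (inclusion C) 2 z)) = 0)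
    (hc : boundary ℓ Γ 1 c = 0)
    (hh : ∀ γ, ρ (α γ) = h * s (ρ γ) * h⁻¹) (hk : ∀ γ, ρ (α γ) = k * s (ρ γ) * k⁻¹)
    (he : boundary ℓ Γ 2 e = t • chainMap ℓ (autHom α) 2 c - c)
    (he' : boundary ℓ Γ 2 e' = t • chainMap ℓ (autHom α) 2 c - c) :
    vol R t s ρ c h e = vol R t s ρ c k e' := by
  have h1 : R (chainMap ℓ ρ 3 e) = R (chainMap ℓ ρ 3 e') := by
    obtain ⟨v, hv⟩ := hΓ3 (e - e') (by rw [map_sub, he, he', sub_self])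
    rw [← sub_eq_zero, ← map_sub, ← map_sub, ← hv, ← boundary_chainMap, hR]
  have hcomm : ∀ γ, s (ρ γ) * (k⁻¹ * h) = (k⁻¹ * h) * s (ρ γ) := fun γ => by
    have h3 := (hk γ).symm.trans (hh γ)
    rw [eq_mul_inv_iff_mul_eq] at h3
    calc s (ρ γ) * (k⁻¹ * h) = k⁻¹ * (k * s (ρ γ) * k⁻¹ * h) := by group
      _ = k⁻¹ * h * s (ρ γ) := by rw [h3]; group
  -- This centralizer is closed, contains the image of `s ∘ ρ`, and is centralized by `k⁻¹ * h`, so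
  -- `F_{k⁻¹h}` of the pushed cycle is decomposable.
  let C : Subgroup H := Subgroup.centralizer {k⁻¹ * h}
  have hC : IsClosed (C : Set H) := Set.isClosed_centralizer _
  let ρC : Γ →ₜ* C :=
    ⟨((s.comp ρ : Γ →ₜ* H) : Γ →* H).codRestrict C fun γ => by
        rw [Subgroup.mem_centralizer_singleton_iff]
        exact hcomm γ,
      (s.comp ρ).continuous_toFun.subtype_mk _⟩
  have hw : chainMap ℓ s 2 (chainMap ℓ ρ 2 c)
      = chainMap ℓ (inclusion C) 2 (chainMap ℓ ρC 2 c) := 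
    chainMap_chainMap_congr (f := ρ) (g := s) (f' := ρC) (g' := inclusion C) (fun _ => rfl) 2 c
  have h2 : R (homotopyF ℓ (k⁻¹ * h) 2 (chainMap ℓ s 2 (chainMap ℓ ρ 2 c))) = 0 := by
    rw [hw]
    refine hdec C hC _ (fun x hx => ?_) _ ?_
    · exact Subgroup.mem_centralizer_singleton_iff.1 hx
    · rw [LinearMap.mem_ker, boundary_chainMap, hc, map_zero]
  have h3 : conjChain ℓ (k⁻¹ * h) 2 (chainMap ℓ s 2 (chainMap ℓ ρ 2 c))
      = chainMap ℓ s 2 (chainMap ℓ ρ 2 c) := by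
    have hs : (autHom (conj H (k⁻¹ * h))).comp (s.comp ρ) = s.comp ρ :=
      ContinuousMonoidHom.ext fun γ => by
        change k⁻¹ * h * s (ρ γ) * (k⁻¹ * h)⁻¹ = s (ρ γ)
        rw [← hcomm, mul_inv_cancel_right]
    rw [← chainMap_comp s ρ, ← chainMap_comp _ (s.comp ρ), hs]
  -- With `h = k * (k⁻¹ * h)`, the factor `k⁻¹ * h` contributes zero and its conjugation fixes the
  -- cycle, which leaves the value at `k`.
  have h4 := apply_homotopyF_mul hR k (k⁻¹ * h) (boundary_push_push_eq_zero (s := s) (ρ := ρ) hc)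
  rw [mul_inv_cancel_left, h2, h3, zero_add] at h4
  rw [vol, vol, h1, h4]

theorem vol_congr_inner [CompactSpace Γ] [T2Space H]
    (hΓ3 : ∀ u, boundary ℓ Γ 2 u = 0 → ∃ v, boundary ℓ Γ 3 v = u)
    (hdec : ∀ (C : Subgroup H), IsClosed (C : Set H) → ∀ g ∈ Subgroup.centralizer (C : Set H),
      ∀ z ∈ cycles ℓ C 1, R (homotopyF ℓ g 2 (chainMap ℓ (inclusion C) 2 z)) = 0)
    (hc : boundary ℓ Γ 1 c = 0) {g : Γ} (hβ : β = conj Γ g * α)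
    (hh : ∀ γ, ρ (α γ) = h * s (ρ γ) * h⁻¹) (hk : ∀ γ, ρ (β γ) = k * s (ρ γ) * k⁻¹)
    (he : boundary ℓ Γ 2 e = t • chainMap ℓ (autHom α) 2 c - c)
    (he' : boundary ℓ Γ 2 e' = t • chainMap ℓ (autHom β) 2 c - c) :
    vol R t s ρ c k e' = vol R t s ρ c h e := by
  rw [← vol_inner_mul hR hc hh he g]
  refine vol_congr (α := β) hR hΓ3 hdec hc hk (fun γ => ?_) he' ?_
  · rw [hβ]
    change ρ (g * α γ * g⁻¹) = _
    rw [map_mul, map_mul, hh, map_inv]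
    group
  · have h1 := boundary_homotopyF_two g c
    rw [hc, map_zero, add_zero] at h1
    rw [map_add, h1, boundary_chainMap, he, hβ, chainMap_autHom_mul, map_sub, map_smul]
    abel

end VolumeIdentities

/-! ### The character on second homology -/

section ActionOnH2

variable {ℓ : ℕ} [Fact ℓ.Prime]
variable {Γ : Type*} [Group Γ] [TopologicalSpace Γ] [IsTopologicalGroup Γ]

variable (ℓ) in
/-- The automorphism `α` acts on `H₂(Γ, ℤ_ℓ)` as multiplication by `t`. -/
def ActsBy (α : Γ ≃ₜ* Γ) (t : ℤ_[ℓ]) : Prop :=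
  ∀ z ∈ cycles ℓ Γ 1, chainMap ℓ (autHom α) 2 z - t • z ∈ boundaries ℓ Γ 2

theorem chainMap_mem_cycles (α : Γ ≃ₜ* Γ) {z : Chains ℓ Γ 2} (hz : z ∈ cycles ℓ Γ 1) :
    chainMap ℓ (autHom α) 2 z ∈ cycles ℓ Γ 1 := by
  rw [LinearMap.mem_ker, boundary_chainMap, LinearMap.mem_ker.1 hz, map_zero]

theorem chainMap_mem_boundaries (α : Γ ≃ₜ* Γ) {z : Chains ℓ Γ 2} (hz : z ∈ boundaries ℓ Γ 2) :
    chainMap ℓ (autHom α) 2 z ∈ boundaries ℓ Γ 2 := by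
  obtain ⟨u, rfl⟩ := hz
  exact ⟨_, boundary_chainMap _ _ _⟩

theorem H2_mk_eq_iff (c c' : cycles ℓ Γ 1) :
    (Submodule.Quotient.mk c : H2 ℓ Γ) = Submodule.Quotient.mk c'
      ↔ c.1 - c'.1 ∈ boundaries ℓ Γ 2 := by
  rw [Submodule.Quotient.eq]
  rfl

theorem ActsBy.mul {α β : Γ ≃ₜ* Γ} {t t' : ℤ_[ℓ]} (hα : ActsBy ℓ α t) (hβ : ActsBy ℓ β t') :
    ActsBy ℓ (α * β) (t * t') := fun z hz => by
  have h1 := hα _ (chainMap_mem_cycles β hz)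
  have h2 := Submodule.smul_mem _ t (hβ z hz)
  have h3 := add_mem h1 h2
  rwa [smul_sub, sub_add_sub_cancel, smul_smul, ← chainMap_autHom_mul] at h3

theorem actsBy_one : ActsBy ℓ (1 : Γ ≃ₜ* Γ) 1 := fun z _ => by
  rw [chainMap_autHom_one, one_smul, sub_self]
  exact zero_mem _

theorem actsBy_conj [CompactSpace Γ] (g : Γ) : ActsBy ℓ (conj Γ g) 1 := fun z hz => by
  refine ⟨homotopyF ℓ g 2 z, ?_⟩
  have h := boundary_homotopyF_two g z
  rw [LinearMap.mem_ker.1 hz, map_zero, add_zero] at h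
  rw [h, one_smul]

theorem exists_eq_conj_mul {α β : Γ ≃ₜ* Γ}
    (h : (QuotientGroup.mk β : Out Γ) = QuotientGroup.mk α) : ∃ g, β = conj Γ g * α := by
  obtain ⟨g, hg⟩ := (inferInstance : (Inn Γ).Normal).mem_comm (QuotientGroup.eq.1 h.symm)
  exact ⟨g, by rw [hg, inv_mul_cancel_right]⟩

theorem exists_actsBy {x : H2 ℓ Γ} (hx : Submodule.span ℤ_[ℓ] {x} = ⊤) (α : Γ ≃ₜ* Γ) :
    ∃ t, ActsBy ℓ α t := by
  obtain ⟨c, rfl⟩ := Submodule.Quotient.mk_surjective _ x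
  have hspan (z : cycles ℓ Γ 1) : ∃ s : ℤ_[ℓ], z.1 - s • c.1 ∈ boundaries ℓ Γ 2 := by
    have hz : (Submodule.Quotient.mk z : H2 ℓ Γ) ∈
        Submodule.span ℤ_[ℓ] {(Submodule.Quotient.mk c : H2 ℓ Γ)} := hx ▸ Submodule.mem_top
    obtain ⟨s, hs⟩ := Submodule.mem_span_singleton.1 hz
    exact ⟨s, (H2_mk_eq_iff z (s • c)).1 hs.symm⟩
  obtain ⟨t, ht⟩ := hspan ⟨_, chainMap_mem_cycles α c.2⟩
  refine ⟨t, fun z hz => ?_⟩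
  obtain ⟨s, hs⟩ := hspan ⟨z, hz⟩
  have h1 := chainMap_mem_boundaries α hs
  have h2 := Submodule.smul_mem _ s ht
  have h3 := Submodule.smul_mem _ t hs
  have h4 := sub_mem (add_mem h1 h2) h3
  simp only [map_sub, map_smul] at h4
  convert h4 using 1
  module

/-- A generator corresponds to a nonzero element of the domain `ℤ_[ℓ]`, so it can be cancelled. -/
theorem eq_of_smul_sub_mem (hΓ2 : Nonempty (H2 ℓ Γ ≃ₗ[ℤ_[ℓ]] ℤ_[ℓ])) {c : cycles ℓ Γ 1}
    (hx : Submodule.span ℤ_[ℓ] {(Submodule.Quotient.mk c : H2 ℓ Γ)} = ⊤) {t t' : ℤ_[ℓ]}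
    (h : t • c.1 - t' • c.1 ∈ boundaries ℓ Γ 2) : t = t' := by
  obtain ⟨f⟩ := hΓ2
  have h1 := congrArg f ((H2_mk_eq_iff (t • c) (t' • c)).2 h)
  rw [Submodule.Quotient.mk_smul, Submodule.Quotient.mk_smul, map_smul, map_smul, smul_eq_mul,
    smul_eq_mul] at h1
  refine mul_right_cancel₀ (fun h0 => ?_) h1
  rw [map_eq_zero_iff f f.injective] at h0
  rw [h0, Submodule.span_zero_singleton] at hx
  have h2 : f.symm 1 ∈ (⊥ : Submodule ℤ_[ℓ] (H2 ℓ Γ)) := hx ▸ Submodule.mem_top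
  rw [Submodule.mem_bot, map_eq_zero_iff _ f.symm.injective] at h2
  exact one_ne_zero h2

theorem ActsBy.unique (hΓ2 : Nonempty (H2 ℓ Γ ≃ₗ[ℤ_[ℓ]] ℤ_[ℓ])) {x : H2 ℓ Γ}
    (hx : Submodule.span ℤ_[ℓ] {x} = ⊤) {α : Γ ≃ₜ* Γ} {t t' : ℤ_[ℓ]} (h : ActsBy ℓ α t)
    (h' : ActsBy ℓ α t') : t = t' := by
  obtain ⟨c, rfl⟩ := Submodule.Quotient.mk_surjective _ x
  refine eq_of_smul_sub_mem hΓ2 hx ?_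
  have h1 := sub_mem (h' c.1 c.2) (h c.1 c.2)
  rwa [sub_sub_sub_cancel_left] at h1

/-- Uniqueness of the scalar makes it multiplicative, hence a unit because automorphisms are
invertible; inner automorphisms have scalar 1. -/
theorem exists_character [CompactSpace Γ] (hΓ2 : Nonempty (H2 ℓ Γ ≃ₗ[ℤ_[ℓ]] ℤ_[ℓ])) {x : H2 ℓ Γ}
    (hx : Submodule.span ℤ_[ℓ] {x} = ⊤) :
    ∃ a : Out Γ →* ℤ_[ℓ]ˣ, ∀ α : Γ ≃ₜ* Γ, ActsBy ℓ α (a (QuotientGroup.mk α) : ℤ_[ℓ]ˣ) := by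
  choose a₀ ha₀ using exists_actsBy hx
  let a₁ : (Γ ≃ₜ* Γ) →* ℤ_[ℓ] :=
    { toFun := a₀
      map_one' := (ha₀ 1).unique hΓ2 hx actsBy_one
      map_mul' := fun α β => (ha₀ (α * β)).unique hΓ2 hx ((ha₀ α).mul (ha₀ β)) }
  refine ⟨QuotientGroup.lift (Inn Γ) a₁.toHomUnits ?_, fun α => ha₀ α⟩
  rintro _ ⟨g, rfl⟩
  exact Units.ext ((ha₀ _).unique hΓ2 hx (actsBy_conj g))

variable {Y : Type*} [TopologicalSpace Y] [CompactSpace Γ] [T2Space Γ]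
  [TotallyDisconnectedSpace Γ]

theorem continuous_chainMap_autHom {f : Y → (Γ ≃ₜ* Γ)}
    (hf : Continuous[inferInstance, autTopology Γ] f) (n : ℕ) (c : Chains ℓ Γ n) :
    Continuous fun y => chainMap ℓ (autHom (f y)) n c := by
  refine continuous_push_family (fun y => _) ?_ c
  refine continuous_pi fun i => ?_
  exact (continuous_autTopology_eval hf).comp
    (continuous_fst.prodMk ((continuous_apply i).comp continuous_snd))

theorem continuous_character {G : Type*} [Group G] [TopologicalSpace G] [IsTopologicalGroup G]
    [CompactSpace G] [T2Space G] (hΓ2 : Nonempty (H2 ℓ Γ ≃ₗ[ℤ_[ℓ]] ℤ_[ℓ])) {x : H2 ℓ Γ}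
    (hx : Submodule.span ℤ_[ℓ] {x} = ⊤) {ψ' : G → (Γ ≃ₜ* Γ)}
    (hψ' : Continuous[inferInstance, autTopology Γ] ψ') {a : G →* ℤ_[ℓ]ˣ}
    (ha : ∀ σ, ActsBy ℓ (ψ' σ) (a σ : ℤ_[ℓ]ˣ)) : Continuous a := by
  obtain ⟨c, rfl⟩ := Submodule.Quotient.mk_surjective _ x
  have hcont : Continuous fun σ => (a σ : ℤ_[ℓ]) := by
    -- The triples `(σ, t, u)` with `∂u = ψ'(σ)(c) - t c` form a closed set, and freeness of `H₂`
    -- forces `t = a σ` on it.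
    refine continuous_of_closed_correspondence (Y := ℤ_[ℓ] × Chains ℓ Γ 3)
      (K := {p | boundary ℓ Γ 2 p.2.2 = chainMap ℓ (autHom (ψ' p.1)) 2 c.1 - p.2.1 • c.1})
      (F := fun p => p.2.1) ?_ (fun σ => ?_) (by fun_prop) ?_
    · refine isClosed_eq ((continuous_boundary 2).comp (by fun_prop)) ?_
      exact ((continuous_chainMap_autHom hψ' 2 c.1).comp continuous_fst).sub
        ((continuous_fst.comp continuous_snd).smul continuous_const)
    · obtain ⟨u, hu⟩ := ha σ c.1 c.2
      exact ⟨(a σ, u), hu⟩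
    · rintro ⟨σ, t, u⟩ hp
      refine eq_of_smul_sub_mem hΓ2 hx ?_
      have h1 := sub_mem (⟨u, hp⟩ : _ ∈ boundaries ℓ Γ 2) (ha σ c.1 c.2)
      rwa [sub_sub_sub_cancel_left] at h1
  refine Units.continuous_iff.2 ⟨hcont, ?_⟩
  simp only [← map_inv]
  exact hcont.comp continuous_inv

end ActionOnH2

/-! ### Continuity of the volume cochain -/

section VolumeCocycle

open IsLocalRing

theorem continuous_prism {H : Type*} [Group H] [TopologicalSpace H] [IsTopologicalGroup H]
    (n : ℕ) (r : Fin (n + 1)) : Continuous fun p : H × (Fin n → H) => prism p.1 n r p.2 := by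
  refine continuous_pi fun k => ?_
  change Continuous fun p : H × (Fin n → H) => Fin.insertNth (α := fun _ => H) r p.1⁻¹
    (fun i : Fin n => if i.castSucc < r then p.2 i else p.1 * p.2 i * p.1⁻¹) k
  induction k using Fin.succAboveCases r with
  | x => simp only [Fin.insertNth_apply_same]; fun_prop
  | p i =>
    simp only [Fin.insertNth_apply_succAbove]
    split_ifs <;> fun_prop

theorem compactSpace_GL {A : Type*} [CommRing A] [TopologicalSpace A] [IsTopologicalRing A]
    [CompactSpace A] [T2Space A] (d : ℕ) : CompactSpace (GL (Fin d) A) := by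
  have : CompactSpace (Matrix (Fin d) (Fin d) A) :=
    inferInstanceAs (CompactSpace (Fin d → Fin d → A))
  infer_instance

variable {ℓ : ℕ} [Fact ℓ.Prime]
variable {Γ : Type*} [Group Γ] [TopologicalSpace Γ] [CompactSpace Γ]
variable {H : Type*} [Group H] [TopologicalSpace H] [IsTopologicalGroup H]
variable {G : Type*} [TopologicalSpace G]
variable {B : Type*} [AddCommGroup B] [Module ℤ_[ℓ] B] [TopologicalSpace B]
  [IsTopologicalAddGroup B] [ContinuousSMul ℤ_[ℓ] B]
variable {R : Chains ℓ H 3 →ₗ[ℤ_[ℓ]] B} {Φ : G → (H →ₜ* H)} {ρ : Γ →ₜ* H}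

theorem continuous_vol (hRc : Continuous R) (hΦ : Continuous fun p : G × H => Φ p.1 p.2)
    {t : G → ℤ_[ℓ]} (ht : Continuous t) (c : Chains ℓ Γ 2) :
    Continuous fun p : G × (H × Chains ℓ Γ 3) => vol R (t p.1) (Φ p.1) ρ c p.2.1 p.2.2 := by
  refine Continuous.sub (hRc.comp ((continuous_push _).comp (by fun_prop)))
    ((ht.comp continuous_fst).smul (hRc.comp ?_))
  -- All dependence on `σ` and `h` is gathered into one continuously varying map, along which the
  -- fixed chain `c` is pushed forward.
  simp only [homotopyF_apply, chainMap, push_push]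
  refine continuous_finsetSum _ fun r _ => Continuous.const_smul ?_ ((-1 : ℤ_[ℓ]) ^ _)
  refine continuous_push_family (fun p : G × (H × Chains ℓ Γ 3) => _) ?_ c
  have h1 : Continuous fun q : (G × (H × Chains ℓ Γ 3)) × (Fin 2 → Γ) =>
      fun i => Φ q.1.1 (ρ (q.2 i)) := continuous_pi fun i => hΦ.comp
    ((continuous_fst.comp continuous_fst).prodMk
      (ρ.continuous_toFun.comp ((continuous_apply i).comp continuous_snd)))
  have h2 : Continuous fun q : (G × (H × Chains ℓ Γ 3)) × (Fin 2 → Γ) => q.1.2.1 := by fun_prop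
  exact (continuous_prism 2 r).comp (h2.prodMk h1)

variable [IsTopologicalGroup Γ] [T2Space Γ] [TotallyDisconnectedSpace Γ]
  [CompactSpace H] [T2Space H] [CompactSpace G] [T2Space G]

/-- The functions `h` and `e` are arbitrary. They only witness that the closed set of admissible
triples surjects onto `G`; `vol_congr` supplies independence of the choice. -/
theorem continuous_vol_of_choices (hR : ∀ v, R (boundary ℓ H 3 v) = 0)
    (hΓ3 : ∀ u, boundary ℓ Γ 2 u = 0 → ∃ v, boundary ℓ Γ 3 v = u)
    (hdec : ∀ (C : Subgroup H), IsClosed (C : Set H) → ∀ g ∈ Subgroup.centralizer (C : Set H),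
      ∀ z ∈ cycles ℓ C 1, R (homotopyF ℓ g 2 (chainMap ℓ (inclusion C) 2 z)) = 0)
    (hRc : Continuous R) (hΦ : Continuous fun p : G × H => Φ p.1 p.2)
    {t : G → ℤ_[ℓ]} (ht : Continuous t) {ψ : G → (Γ ≃ₜ* Γ)}
    (hψ : Continuous[inferInstance, autTopology Γ] ψ) {c : Chains ℓ Γ 2}
    (hc : boundary ℓ Γ 1 c = 0) {h : G → H} {e : G → Chains ℓ Γ 3}
    (hh : ∀ σ γ, ρ (ψ σ γ) = h σ * Φ σ (ρ γ) * (h σ)⁻¹)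
    (he : ∀ σ, boundary ℓ Γ 2 (e σ) = t σ • chainMap ℓ (autHom (ψ σ)) 2 c - c) :
    Continuous fun σ => vol R (t σ) (Φ σ) ρ c (h σ) (e σ) := by
  refine continuous_of_closed_correspondence (Y := H × Chains ℓ Γ 3)
    (K := {p | (∀ γ, ρ (ψ p.1 γ) = p.2.1 * Φ p.1 (ρ γ) * p.2.1⁻¹) ∧
      boundary ℓ Γ 2 p.2.2 = t p.1 • chainMap ℓ (autHom (ψ p.1)) 2 c - c})
    ?_ (fun σ => ⟨(h σ, e σ), hh σ, he σ⟩) (continuous_vol hRc hΦ ht c)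
    (fun p hp => vol_congr hR hΓ3 hdec hc (hh p.1) hp.1 (he p.1) hp.2)
  refine IsClosed.and ?_ (isClosed_eq ?_ ?_)
  · rw [Set.ofPred_forall]
    refine isClosed_iInter fun γ => isClosed_eq ?_ ?_
    · exact ρ.continuous_toFun.comp ((continuous_autTopology_eval hψ).comp
        (continuous_fst.prodMk continuous_const))
    · have h1 : Continuous fun p : G × (H × Chains ℓ Γ 3) => Φ p.1 (ρ γ) :=
        hΦ.comp (continuous_fst.prodMk continuous_const)
      have h2 : Continuous fun p : G × (H × Chains ℓ Γ 3) => p.2.1 := by fun_prop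
      exact (h2.mul h1).mul h2.inv
  · exact (continuous_boundary 2).comp (by fun_prop)
  · exact ((ht.comp continuous_fst).smul
      ((continuous_chainMap_autHom hψ 2 c).comp continuous_fst)).sub continuous_const

end VolumeCocycle

/-! ### Cocycle relation and independence of choices -/

section VolumeClass

variable {ℓ : ℕ} [Fact ℓ.Prime]
variable {Γ : Type*} [Group Γ] [TopologicalSpace Γ] [IsTopologicalGroup Γ] [CompactSpace Γ]
variable {H : Type*} [Group H] [TopologicalSpace H] [IsTopologicalGroup H] [CompactSpace H]
  [T2Space H]
variable {B : Type*} [AddCommGroup B] [Module ℤ_[ℓ] B]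
variable {R : Chains ℓ H 3 →ₗ[ℤ_[ℓ]] B} (hR : ∀ v, R (boundary ℓ H 3 v) = 0)
  (hΓ3 : ∀ u, boundary ℓ Γ 2 u = 0 → ∃ v, boundary ℓ Γ 3 v = u)
  (hdec : ∀ (C : Subgroup H), IsClosed (C : Set H) → ∀ g ∈ Subgroup.centralizer (C : Set H),
    ∀ z ∈ cycles ℓ C 1, R (homotopyF ℓ g 2 (chainMap ℓ (inclusion C) 2 z)) = 0)
include hR hΓ3 hdec

theorem vol_mul_of_choices {G : Type*} [Group G] {Φ : G → (H →ₜ* H)}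
    (hΦ : ∀ σ τ, Φ (σ * τ) = (Φ σ).comp (Φ τ)) {t : G →* ℤ_[ℓ]} {E : G → B →ₗ[ℤ_[ℓ]] B}
    (hE : ∀ σ u, R (chainMap ℓ (Φ σ) 3 u) = E σ (R u)) {ψ : G →* Out Γ} {ψ₁ : G → (Γ ≃ₜ* Γ)}
    (hψ : ∀ σ, (QuotientGroup.mk (ψ₁ σ) : Out Γ) = ψ σ) {ρ : Γ →ₜ* H} {c : Chains ℓ Γ 2}
    (hc : boundary ℓ Γ 1 c = 0) {h : G → H} {e : G → Chains ℓ Γ 3}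
    (hh : ∀ σ γ, ρ (ψ₁ σ γ) = h σ * Φ σ (ρ γ) * (h σ)⁻¹)
    (he : ∀ σ, boundary ℓ Γ 2 (e σ) = t σ • chainMap ℓ (autHom (ψ₁ σ)) 2 c - c) (σ τ : G) :
    vol R (t (σ * τ)) (Φ (σ * τ)) ρ c (h (σ * τ)) (e (σ * τ))
      = vol R (t σ) (Φ σ) ρ c (h σ) (e σ)
        + t σ • E σ (vol R (t τ) (Φ τ) ρ c (h τ) (e τ)) := by
  obtain ⟨g, hg⟩ : ∃ g, ψ₁ (σ * τ) = conj Γ g * (ψ₁ σ * ψ₁ τ) :=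
    exists_eq_conj_mul (by rw [hψ, map_mul, ← hψ, ← hψ]; rfl)
  -- The right side becomes the volume of `ψ₁ σ * ψ₁ τ` with its composite choices, which differs
  -- from that of `ψ₁ (σ * τ)` by an inner automorphism only.
  rw [← vol_mul hR (hE σ) hc (hh σ) (hh τ) (he τ), ← map_mul, ← hΦ]
  refine vol_congr_inner hR hΓ3 hdec hc hg (fun γ => ?_) (hh _) ?_ (he _)
  · change ρ (ψ₁ σ (ψ₁ τ γ)) = _
    rw [hh, hh, map_mul, map_mul, map_inv, hΦ]
    change _ = h σ * Φ σ (h τ) * Φ σ (Φ τ (ρ γ)) * (h σ * Φ σ (h τ))⁻¹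
    group
  · rw [map_add, map_smul, he, boundary_chainMap, he, chainMap_autHom_mul, map_sub, map_smul,
      map_mul, mul_smul, smul_sub]
    abel

/-- Changing the cycle in its class, the automorphism by an inner one, the intertwining element,
the bounding chain and the homomorphism in its conjugacy class changes the volume by a coboundary
that does not depend on the automorphism. -/
theorem vol_change {t : ℤ_[ℓ]} {s : H →ₜ* H} {E : B →ₗ[ℤ_[ℓ]] B}
    (hE : ∀ u, R (chainMap ℓ s 3 u) = E (R u)) {ρ ρ₁ : Γ →ₜ* H} {g : H}
    (hg : ∀ γ, ρ₁ γ = g * ρ γ * g⁻¹) {α β : Γ ≃ₜ* Γ}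
    (hαβ : (QuotientGroup.mk β : Out Γ) = QuotientGroup.mk α) {c c₁ : Chains ℓ Γ 2}
    (hc : boundary ℓ Γ 1 c = 0) (hc₁ : boundary ℓ Γ 1 c₁ = 0) {w : Chains ℓ Γ 3} (hw : boundary ℓ Γ 2 w = c₁ - c) {h k : H}
    {e e₁ : Chains ℓ Γ 3} (hh : ∀ γ, ρ (α γ) = h * s (ρ γ) * h⁻¹)
    (hk : ∀ γ, ρ₁ (β γ) = k * s (ρ₁ γ) * k⁻¹)
    (he : boundary ℓ Γ 2 e = t • chainMap ℓ (autHom α) 2 c - c)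
    (he₁ : boundary ℓ Γ 2 e₁ = t • chainMap ℓ (autHom β) 2 c₁ - c₁) :
    vol R t s ρ₁ c₁ k e₁ = vol R t s ρ c h e
      + (t • E (R (chainMap ℓ ρ₁ 3 w + homotopyF ℓ g 2 (chainMap ℓ ρ 2 c)))
        - R (chainMap ℓ ρ₁ 3 w + homotopyF ℓ g 2 (chainMap ℓ ρ 2 c))) := by
  obtain ⟨x, hx⟩ := exists_eq_conj_mul hαβ
  obtain rfl : c₁ = c + boundary ℓ Γ 2 w := by rw [hw, add_sub_cancel]
  have hh₁ : ∀ γ, ρ₁ (α γ) = g * h * (s g)⁻¹ * s (ρ₁ γ) * (g * h * (s g)⁻¹)⁻¹ := fun γ => by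
    rw [hg, hg, hh, map_mul, map_mul, map_inv]
    group
  -- The lift is changed back to `α` first, then the cycle, and `ρ₁` last; this is why `w` appears
  -- pushed forward by `ρ₁` and the homotopy term uses `ρ` and the original `c`.
  rw [vol_congr_inner (e := e + (t • chainMap ℓ (autHom α) 3 w - w)) hR hΓ3 hdec hc₁ hx hh₁ hk
      ?_ he₁, vol_add_boundary hR hE hh₁, vol_conj hR hE hc hh he hg]
  · simp only [map_add, smul_add]
    abel
  · simp only [map_add, map_sub, map_smul, he, boundary_chainMap, smul_add]
    abel

end VolumeClass

end ProfiniteVolume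

end

/-! ### The class of the volume cocycle -/

open ProfiniteVolume in
theorem proposition3p4
    {ℓ : ℕ} [Fact ℓ.Prime]
    -- the profinite group `Γ`
    {Γ : Type*} [Group Γ] [TopologicalSpace Γ] [IsTopologicalGroup Γ]
    [CompactSpace Γ] [T2Space Γ] [TotallyDisconnectedSpace Γ]
    (hΓfg : ∃ S : Finset Γ, (Subgroup.closure (S : Set Γ)).topologicalClosure = ⊤)
    (hΓ2 : Nonempty (H2 ℓ Γ ≃ₗ[ℤ_[ℓ]] ℤ_[ℓ]))
    (hΓ3 : Subsingleton (H3 ℓ Γ))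
    -- the complete local Noetherian `O`-algebra `A`, with its adic topology
    {O A : Type*} [CommRing O] [CommRing A] [Algebra O A] [IsLocalRing A] [IsNoetherianRing A]
    [IsAdicComplete (IsLocalRing.maximalIdeal A) A]
    [Finite (IsLocalRing.ResidueField A)] [CharP (IsLocalRing.ResidueField A) ℓ]
    [TopologicalSpace A] [IsTopologicalRing A] (hA : IsAdic (IsLocalRing.maximalIdeal A))
    -- the representation `ρ`
    {d : ℕ} (hd : 2 ≤ d) (ρ : Γ →ₜ* GL (Fin d) A)
    -- the profinite group `G`, with `φ`, `ψ` and `ψ'`, a continuous lift of `ψ`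
    {G : Type*} [Group G] [TopologicalSpace G] [IsTopologicalGroup G]
    [CompactSpace G] [T2Space G] [TotallyDisconnectedSpace G]
    (φ : G →* (A ≃ₐ[O] A)) (hφ : Continuous[inferInstance, algAutTopology O A] φ)
    (ψ : G →* Out Γ) (ψ' : G → (Γ ≃ₜ* Γ)) (hψ'cont : Continuous[inferInstance, autTopology Γ] ψ')
    (hψ' : ∀ σ, (QuotientGroup.mk (ψ' σ) : Out Γ) = ψ σ)
    -- the topological `ℤ_ℓ`-module `B` with its continuous `G`-action, and the regulator `r`
    {B : Type*} [AddCommGroup B] [Module ℤ_[ℓ] B] [TopologicalSpace B]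
    [IsTopologicalAddGroup B] [ContinuousSMul ℤ_[ℓ] B]
    [DistribMulAction G B] [SMulCommClass G ℤ_[ℓ] B] [ContinuousSMul G B]
    (r : D3 ℓ (GL (Fin d) A) →L[ℤ_[ℓ]] B)
    (hrG : ∀ (σ : G) (u : Chains ℓ (GL (Fin d) A) 3),
      r ((boundaries ℓ (GL (Fin d) A) 3).mkQ (chainMap ℓ (glMap hA d (φ σ)) 3 u))
        = σ • r ((boundaries ℓ (GL (Fin d) A) 3).mkQ u))
    (hrdec : ∀ w ∈ decomposable ℓ (GL (Fin d) A), r w = 0)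
    -- each twisted representation `γ ↦ φ(σ)⁻¹(ρ(ψ'(σ)(γ)))` is equivalent to `ρ`
    (hρ : ∀ σ : G, RepEquiv (fun γ => glMap hA d (φ σ)⁻¹ (ρ (ψ' σ γ))) ρ)
    -- the generator `x` of `H₂(Γ, ℤ_ℓ)`
    (x : H2 ℓ Γ) (hx : Submodule.span ℤ_[ℓ] {x} = ⊤) :
    -- the character `a` through which `G` acts on `H₂(Γ, ℤ_ℓ)`
    ∃ a : G →* ℤ_[ℓ]ˣ, Continuous a ∧
      (∀ (σ : G) (α : Γ ≃ₜ* Γ), (QuotientGroup.mk α : Out Γ) = ψ σ → ∀ z ∈ cycles ℓ Γ 1,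
        chainMap ℓ (autHom α) 2 z - (a σ : ℤ_[ℓ]) • z ∈ boundaries ℓ Γ 2) ∧
      -- the class `κ` depends only on `x`, `ψ`, `φ` and the equivalence class of `ρ`: all the
      -- choices of `ρ₁` equivalent to `ρ`, of a continuous lift `ψ₁` of `ψ`, of a cycle `c` in
      -- the class `x`, of the `h σ` and of the `e σ` give continuous 1-cocycles with class `κ`
      ∃ κ : H1cts (twist B a),
        ∀ ρ₁ : Γ →ₜ* GL (Fin d) A, RepEquiv ρ ρ₁ →
        ∀ ψ₁ : G → (Γ ≃ₜ* Γ), Continuous[inferInstance, autTopology Γ] ψ₁ →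
          (∀ σ, (QuotientGroup.mk (ψ₁ σ) : Out Γ) = ψ σ) →
        ∀ c : ↥(cycles ℓ Γ 1), Submodule.Quotient.mk c = x →
          (∀ σ, ∃ g : GL (Fin d) A, ∀ γ, ρ₁ (ψ₁ σ γ) = g * glMap hA d (φ σ) (ρ₁ γ) * g⁻¹) ∧
          (∀ σ, ∃ u : Chains ℓ Γ 3, boundary ℓ Γ 2 u
            = (((a σ)⁻¹ : ℤ_[ℓ]ˣ) : ℤ_[ℓ]) • chainMap ℓ (autHom (ψ₁ σ)) 2 c.1 - c.1) ∧
          ∀ (h : G → GL (Fin d) A) (e : G → Chains ℓ Γ 3),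
            (∀ σ γ, ρ₁ (ψ₁ σ γ) = h σ * glMap hA d (φ σ) (ρ₁ γ) * (h σ)⁻¹) →
            (∀ σ, boundary ℓ Γ 2 (e σ)
              = (((a σ)⁻¹ : ℤ_[ℓ]ˣ) : ℤ_[ℓ]) • chainMap ℓ (autHom (ψ₁ σ)) 2 c.1 - c.1) →
            ∃ f : ↥(Z1cts (twist B a)),
              (f : G → B) = volCochain hA φ r a ρ₁ c.1 h e ∧ Submodule.Quotient.mk f = κ := by

  have hAc : CompactSpace A := compactSpace_of_isAdic hA
  have hA2 : T2Space A := hA.isHausdorff_iff.1 inferInstance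
  have hGL : CompactSpace (GL (Fin d) A) := compactSpace_GL d
  obtain ⟨a', ha'⟩ := exists_character hΓ2 hx
  let a : G →* ℤ_[ℓ]ˣ := a'.comp ψ
  have ha : ∀ (σ : G) (α : Γ ≃ₜ* Γ), (QuotientGroup.mk α : Out Γ) = ψ σ →
      ActsBy ℓ α (a σ : ℤ_[ℓ]ˣ) := fun σ α hα => by
    have := ha' α
    rwa [hα] at this
  have hacont : Continuous a := continuous_character hΓ2 hx hψ'cont fun σ => ha σ _ (hψ' σ)
  refine ⟨a, hacont, ha, ?_⟩
  let t : G →* ℤ_[ℓ] := (Units.coeHom ℤ_[ℓ]).comp a⁻¹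
  have ht : Continuous t := Units.continuous_val.comp hacont.inv
  let Φ : G → (GL (Fin d) A →ₜ* GL (Fin d) A) := fun σ => glMap hA d (φ σ)
  have hΦmul : ∀ σ τ, Φ (σ * τ) = (Φ σ).comp (Φ τ) := fun σ τ => by
    refine ContinuousMonoidHom.ext fun x => ?_
    change glMap hA d (φ (σ * τ)) x = _
    rw [map_mul]
    rfl
  have hΦ : Continuous fun p : G × GL (Fin d) A => Φ p.1 p.2 := continuous_glMap_eval hA d hφ
  let R : Chains ℓ (GL (Fin d) A) 3 →ₗ[ℤ_[ℓ]] B :=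
    r.toLinearMap ∘ₗ (boundaries ℓ (GL (Fin d) A) 3).mkQ
  have hRc : Continuous R := r.continuous.comp (Submodule.continuous_mkQ _)
  have hR : ∀ v, R (boundary ℓ (GL (Fin d) A) 3 v) = 0 := fun v => by
    have hv : (boundaries ℓ (GL (Fin d) A) 3).mkQ (boundary ℓ _ 3 v) = 0 :=
      (Submodule.Quotient.mk_eq_zero _).2 ⟨v, rfl⟩
    change r (Submodule.mkQ _ _) = 0
    rw [hv, map_zero]
  let E : G → B →ₗ[ℤ_[ℓ]] B := fun σ => DistribSMul.toLinearMap ℤ_[ℓ] B σ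
  have hE : ∀ σ u, R (chainMap ℓ (Φ σ) 3 u) = E σ (R u) := hrG
  have hdec : ∀ (C : Subgroup (GL (Fin d) A)), IsClosed (C : Set (GL (Fin d) A)) →
      ∀ g ∈ Subgroup.centralizer (C : Set (GL (Fin d) A)), ∀ z ∈ cycles ℓ C 1,
        R (homotopyF ℓ g 2 (chainMap ℓ (inclusion C) 2 z)) = 0 := fun C hC g hg z hz =>
    hrdec _ (Submodule.subset_span ⟨C, hC, g, hg, z, hz, rfl⟩)
  have hΓ3' : ∀ u, boundary ℓ Γ 2 u = 0 → ∃ v, boundary ℓ Γ 3 v = u := fun u hu => by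
    have h1 : (Submodule.Quotient.mk ⟨u, hu⟩ : H3 ℓ Γ) = 0 := Subsingleton.elim _ _
    exact (Submodule.Quotient.mk_eq_zero _).1 h1
  have hexh : ∀ ρ₁ : Γ →ₜ* GL (Fin d) A, RepEquiv ρ ρ₁ → ∀ ψ₁ : G → (Γ ≃ₜ* Γ),
      (∀ σ, (QuotientGroup.mk (ψ₁ σ) : Out Γ) = ψ σ) →
      ∀ σ, ∃ g : GL (Fin d) A, ∀ γ, ρ₁ (ψ₁ σ γ) = g * Φ σ (ρ₁ γ) * g⁻¹ := by
    rintro ρ₁ ⟨g, hg⟩ ψ₁ hψ₁ σ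
    obtain ⟨k, hk⟩ := hρ σ
    obtain ⟨x, hx⟩ := exists_eq_conj_mul ((hψ₁ σ).trans (hψ' σ).symm)
    have h1 : ∀ y, Φ σ (glMap hA d (φ σ)⁻¹ y) = y := fun y => by
      ext i j
      exact (φ σ).apply_symm_apply _
    have h2 : ∀ γ, ρ (ψ' σ γ) = (Φ σ k)⁻¹ * Φ σ (ρ γ) * Φ σ k := fun γ => by
      rw [hk γ, map_mul, map_mul, map_inv, h1]
      group
    -- The intertwiner `(Φ σ k)⁻¹` for `ρ` and `ψ'` is corrected by `ρ x` for the inner change of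
    -- lift, and by `g` and `(Φ σ g)⁻¹` for the passage to `ρ₁`.
    refine ⟨g * ρ x * (Φ σ k)⁻¹ * (Φ σ g)⁻¹, fun γ => ?_⟩
    rw [hx]
    change ρ₁ (x * ψ' σ γ * x⁻¹) = _
    rw [hg, map_mul, map_mul, h2, hg, map_mul, map_mul, map_inv, map_inv]
    group
  have hexe : ∀ ψ₁ : G → (Γ ≃ₜ* Γ), (∀ σ, (QuotientGroup.mk (ψ₁ σ) : Out Γ) = ψ σ) →
      ∀ c : ↥(cycles ℓ Γ 1), ∀ σ, ∃ u : Chains ℓ Γ 3,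
        boundary ℓ Γ 2 u = t σ • chainMap ℓ (autHom (ψ₁ σ)) 2 c.1 - c.1 := by
    intro ψ₁ hψ₁ c σ
    obtain ⟨u, hu⟩ := ha σ (ψ₁ σ) (hψ₁ σ) c.1 c.2
    refine ⟨t σ • u, ?_⟩
    rw [map_smul, hu, smul_sub, smul_smul, show t σ * ((a σ : ℤ_[ℓ]ˣ) : ℤ_[ℓ]) = 1 from
      Units.inv_mul _, one_smul]
  have hZ1 : ∀ ρ₁ : Γ →ₜ* GL (Fin d) A, ∀ ψ₁ : G → (Γ ≃ₜ* Γ),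
      Continuous[inferInstance, autTopology Γ] ψ₁ →
      (∀ σ, (QuotientGroup.mk (ψ₁ σ) : Out Γ) = ψ σ) → ∀ c : ↥(cycles ℓ Γ 1),
      ∀ (h : G → GL (Fin d) A) (e : G → Chains ℓ Γ 3),
        (∀ σ γ, ρ₁ (ψ₁ σ γ) = h σ * Φ σ (ρ₁ γ) * (h σ)⁻¹) →
        (∀ σ, boundary ℓ Γ 2 (e σ) = t σ • chainMap ℓ (autHom (ψ₁ σ)) 2 c.1 - c.1) →
        volCochain hA φ r a ρ₁ c.1 h e ∈ Z1cts (twist B a) :=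
    fun ρ₁ ψ₁ hψ₁c hψ₁ c h e hh he =>
      ⟨continuous_vol_of_choices hR hΓ3' hdec hRc hΦ ht hψ₁c c.2 hh he,
        vol_mul_of_choices hR hΓ3' hdec hΦmul (t := t) hE hψ₁ c.2 hh he⟩
  have hρρ : RepEquiv ρ ρ := ⟨1, fun γ => by simp⟩
  obtain ⟨c₀, hc₀⟩ := Submodule.Quotient.mk_surjective _ x
  choose h₀ hh₀ using hexh ρ hρρ ψ' hψ'
  choose e₀ he₀ using hexe ψ' hψ' c₀
  refine ⟨Submodule.Quotient.mk ⟨_, hZ1 ρ ψ' hψ'cont hψ' c₀ h₀ e₀ hh₀ he₀⟩, ?_⟩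
  intro ρ₁ hρ₁ ψ₁ hψ₁c hψ₁ c hc
  refine ⟨hexh ρ₁ hρ₁ ψ₁ hψ₁, hexe ψ₁ hψ₁ c, fun h e hh he => ?_⟩
  refine ⟨⟨_, hZ1 ρ₁ ψ₁ hψ₁c hψ₁ c h e hh he⟩, rfl, ?_⟩
  obtain ⟨g, hg⟩ := hρ₁
  obtain ⟨w, hw⟩ := (H2_mk_eq_iff c c₀).1 (hc.trans hc₀.symm)
  rw [Submodule.Quotient.eq]
  -- The element comes from `vol_change`. It involves only `ρ`, `ρ₁`, `g`, `c₀` and `w`, so it is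
  -- the same for all `σ`, as a coboundary requires.
  refine ⟨R (chainMap ℓ ρ₁ 3 w + homotopyF ℓ g 2 (chainMap ℓ ρ 2 c₀.1)), funext fun σ => ?_⟩
  have key := vol_change hR hΓ3' hdec (hE σ) hg ((hψ₁ σ).trans (hψ' σ).symm) c₀.2 c.2 hw (hh₀ σ)
    (hh σ) (he₀ σ) (he σ)
  exact (sub_eq_iff_eq_add'.2 key).symm
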